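/- All graphs are finite, simple and have at least one vertex. For a graph $G$ let $v(G)$ be its number of vertices, $m_k(G)$ the number of matchings with exactly $k$ edges, $\mathbb M(G)=\sum_k m_k(G)$ the number of all matchings (including the empty one), $\operatorname{pm}(G)$ the number of perfect matchings, and $\nu(G)$ the maximal size of a matching. Let $\gamma_G$ be the number of edges of a uniformly random matching of $G$, with expectation $\mathbb E\gamma_G=\frac{\sum_k k\,m_k(G)}{\sum_k m_k(G)}$ and variance $\mathbb D^2\gamma_G=\frac{\sum_k (k-\mathbb E\gamma_G)^2m_k(G)}{\sum_k m_k(G)}$. The matching polynomial is $\mu(G,x)=\sum_{k=0}^{\lfloor v(G)/2\rfloor}(-1)^k m_k(G)x^{v(G)-2k}$, and the matching measure $\rho_G$ is the uniform probability distribution on the $v(G)$ complex roots of $\mu(G,x)$, counted with multiplicity. A sequence $(G_n)$ with uniformly bounded degrees is Benjamini–Schramm convergent if, for every finite rooted graph $\alpha$ and every integer $r\ge 1$, the probability that the $r$-ball centered at a uniformly random vertex of $G_n$ is isomorphic to $\alpha$ as a rooted graph converges as $n\to\infty$. A real graph parameter $p$ is estimable if $p(G_n)$ converges to a real number for every Benjamini–Schramm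 convergent sequence $(G_n)$ with uniformly bounded degrees. **Theorem.** Let $d\ge 2$ be an integer, let $(G_n)$ be a Benjamini–Schramm convergent sequence of graphs in which all degrees are at most $d$, and set $\omega=2\sqrt{d-1}$, $K=[-\omega,\omega]\subset\mathbb R\subset\mathbb C$. Then all the matching measures $\rho_{G_n}$ are supported on $K$, and they converge weakly to a probability measure $\rho$ on $K$. Moreover, as $n\to\infty$: (a) $$\frac{\ln\mathbb M(G_n)}{v(G_n)}\to\frac12\int_K\ln(1+x^2)\,d\rho(x),\qquad \frac{\mathbb E\gamma_{G_n}}{v(G_n)}\to\frac12\int_K\frac{x^2}{1+x^2}\,d\rho(x),$$ $$\frac{\mathbb D^2\gamma_{G_n}}{v(G_n)}\to\frac12\int_K\frac{x^2}{(1+x^2)^2}\,d\rho(x),\qquad \frac{\nu(G_n)}{v(G_n)}\to\frac{1-\rho(\{0\})}{2}.$$ In particular, $(\ln\mathbb M)/v$, $\mathbb E\gamma/v$, $\mathbb D^2\gamma/v$ and $\nu/v$ are estimable graph parameters. (b) $$\limsup_{n\to\infty}\frac{\ln\operatorname{pm}(G_n)}{v(G_n)}\le\int_K\ln|x|\,d\rho(x),$$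 where $\ln 0=-\infty$ and both sides are elements of $[-\infty,\infty)$. -/

import Mathlib

open Filter Topology MeasureTheory Polynomial
open scoped ENNReal

universe u

namespace MatchingBS

section Graphs

variable {V : Type u}

/-- The set of vertices at distance at most `r` from `v`; vertices in other connected components
have extended distance `⊤` and are excluded. -/
def ballSet (G : SimpleGraph V) (v : V) (r : ℕ) : Set V := {w | G.edist v w ≤ r}

/-- The center, as a vertex of the ball. -/
def ballCenter (G : SimpleGraph V) (v : V) (r : ℕ) : ballSet G v r :=
  ⟨v, by simp [ballSet]⟩

/-- The `r`-ball of `G` centered at `v` (the induced subgraph, rooted at `v`) is isomorphic, as a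
rooted graph, to the graph `α` rooted at `o`. -/
def BallIso (G : SimpleGraph V) (v : V) (r : ℕ) {W : Type*} (α : SimpleGraph W) (o : W) : Prop :=
  ∃ φ : G.induce (ballSet G v r) ≃g α, φ (ballCenter G v r) = o

/-- The probability that the `r`-ball centered at a uniformly random vertex of `G` is isomorphic,
as a rooted graph, to `(α, o)`. -/
noncomputable def ballProb (G : SimpleGraph V) {W : Type*} (α : SimpleGraph W) (o : W) (r : ℕ) :
    ℝ :=
  (Nat.card {v : V // BallIso G v r α o} : ℝ) / (Nat.card V : ℝ)

/-- The number `m_k(G)` of matchings of `G` with exactly `k` edges. -/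
noncomputable def numMatchingsOfSize (G : SimpleGraph V) (k : ℕ) : ℕ :=
  Nat.card {M : G.Subgraph // M.IsMatching ∧ M.edgeSet.ncard = k}

/-- The number of all matchings of `G` (the empty matching included). -/
noncomputable def numMatchings (G : SimpleGraph V) : ℕ :=
  Nat.card {M : G.Subgraph // M.IsMatching}

/-- The number of perfect matchings of `G`. -/
noncomputable def numPerfectMatchings (G : SimpleGraph V) : ℕ :=
  Nat.card {M : G.Subgraph // M.IsPerfectMatching}

/-- The maximal number of edges of a matching of `G`. -/
noncomputable def matchingNumber (G : SimpleGraph V) : ℕ :=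
  sSup {k : ℕ | ∃ M : G.Subgraph, M.IsMatching ∧ M.edgeSet.ncard = k}

/-- The expected number of edges of a uniformly random matching of `G`. -/
noncomputable def expectedMatchingSize (G : SimpleGraph V) : ℝ :=
  (∑ k ∈ Finset.range (Nat.card V / 2 + 1), (k : ℝ) * numMatchingsOfSize G k) /
    ∑ k ∈ Finset.range (Nat.card V / 2 + 1), (numMatchingsOfSize G k : ℝ)

/-- The variance of the number of edges of a uniformly random matching of `G`. -/
noncomputable def varianceMatchingSize (G : SimpleGraph V) : ℝ :=
  (∑ k ∈ Finset.range (Nat.card V / 2 + 1),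
      ((k : ℝ) - expectedMatchingSize G) ^ 2 * numMatchingsOfSize G k) /
    ∑ k ∈ Finset.range (Nat.card V / 2 + 1), (numMatchingsOfSize G k : ℝ)

/-- The matching polynomial `∑_{k ≤ v/2} (-1)^k m_k(G) x^(v - 2k)`, where `v` is the number of
vertices. -/
noncomputable def matchingPoly (G : SimpleGraph V) : ℝ[X] :=
  ∑ k ∈ Finset.range (Nat.card V / 2 + 1),
    C ((-1 : ℝ) ^ k * (numMatchingsOfSize G k : ℝ)) * X ^ (Nat.card V - 2 * k)

/-- The matching measure: the uniform distribution on the complex roots of the matching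
polynomial, counted with multiplicity. -/
noncomputable def matchingMeasure (G : SimpleGraph V) : Measure ℂ :=
  (Nat.card V : ℝ≥0∞)⁻¹ •
    ∑ z ∈ ((matchingPoly G).aroots ℂ).toFinset,
      (((matchingPoly G).aroots ℂ).count z : ℝ≥0∞) • Measure.dirac z

theorem numMatchingsOfSize_zero [Finite V] (G : SimpleGraph V) : numMatchingsOfSize G 0 = 1 := by
  rw [numMatchingsOfSize, Nat.card_eq_one_iff_unique]
  refine ⟨⟨?_⟩, ⟨⟨⊥, ?_, ?_⟩⟩⟩
  · have key : ∀ M : G.Subgraph, M.IsMatching → M.edgeSet.ncard = 0 → M = ⊥ := by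
      intro M hM h0
      have h0' : M.edgeSet = ∅ := (Set.ncard_eq_zero (Set.toFinite _)).1 h0
      have hadj : ∀ a b, ¬ M.Adj a b := by
        intro a b hab
        have : s(a, b) ∈ M.edgeSet := hab
        rw [h0'] at this
        exact this
      ext a b
      · constructor
        · intro ha
          obtain ⟨w, hw, -⟩ := hM ha
          exact (hadj _ _ hw).elim
        · intro ha
          exact ha.elim
      · constructor
        · intro h
          exact (hadj _ _ h).elim
        · intro h
          exact h.elim
    rintro ⟨M, hM, h0⟩ ⟨N, hN, h0'⟩
    exact Subtype.ext ((key M hM h0).trans (key N hN h0').symm)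
  · intro v hv
    exact hv.elim
  · simp

theorem matchingPoly_coeff_card [Finite V] (G : SimpleGraph V) :
    (matchingPoly G).coeff (Nat.card V) = 1 := by
  rw [matchingPoly, finsetSum_coeff, Finset.sum_eq_single 0]
  · simp [numMatchingsOfSize_zero]
  · intro k hk hk0
    rw [coeff_C_mul, coeff_X_pow, if_neg, mul_zero]
    have := Finset.mem_range.1 hk
    omega
  · simp

theorem matchingPoly_natDegree [Finite V] (G : SimpleGraph V) :
    (matchingPoly G).natDegree = Nat.card V := by
  apply le_antisymm
  · refine natDegree_sum_le_of_forall_le _ _ fun k _ => ?_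
    exact (natDegree_C_mul_X_pow_le _ _).trans (Nat.sub_le _ _)
  · apply le_natDegree_of_ne_zero
    rw [matchingPoly_coeff_card]
    exact one_ne_zero

instance matchingMeasure_isProbabilityMeasure [Finite V] [Nonempty V] (G : SimpleGraph V) :
    IsProbabilityMeasure (matchingMeasure G) := by
  constructor
  have hcard : ((matchingPoly G).aroots ℂ).card = Nat.card V := by
    rw [← matchingPoly_natDegree G]
    exact IsAlgClosed.card_aroots_eq_natDegree
  have hv : (Nat.card V : ℝ≥0∞) ≠ 0 := by
    exact_mod_cast Nat.card_pos.ne'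
  rw [matchingMeasure, Measure.smul_apply, Measure.finsetSum_apply]
  simp only [Measure.smul_apply, measure_univ, smul_eq_mul, mul_one]
  rw [← Nat.cast_sum, Multiset.toFinset_sum_count_eq, hcard]
  exact ENNReal.inv_mul_cancel hv (ENNReal.natCast_ne_top _)

/-- The matching measure as an element of the space of probability measures, with its topology of
weak convergence. -/
noncomputable def matchingProbMeasure [Finite V] [Nonempty V] (G : SimpleGraph V) :
    ProbabilityMeasure ℂ :=
  ⟨matchingMeasure G, inferInstance⟩

end Graphs

/-- All degrees in all graphs of the sequence are at most `d`. -/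
def DegreeBound {V : ℕ → Type u} (G : ∀ n, SimpleGraph (V n)) (d : ℕ) : Prop :=
  ∀ n v, ((G n).neighborSet v).encard ≤ d

/-- Convergence of all neighbourhood statistics. Every finite rooted graph is isomorphic to one
whose vertex set is some `Fin m`, and the statistics depend only on the isomorphism class. -/
def BSConvergent {V : ℕ → Type u} (G : ∀ n, SimpleGraph (V n)) : Prop :=
  ∀ (m : ℕ) (α : SimpleGraph (Fin m)) (o : Fin m) (r : ℕ), 0 < r →
    ∃ p : ℝ, Tendsto (fun n => ballProb (G n) α o r) atTop (𝓝 p)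

/-- A real graph parameter is estimable if it converges along every Benjamini--Schramm convergent
sequence of (nonempty) finite graphs with uniformly bounded degrees. -/
def Estimable (p : ∀ V : Type u, SimpleGraph V → ℝ) : Prop :=
  ∀ (V : ℕ → Type u) [∀ n, Finite (V n)] [∀ n, Nonempty (V n)] (G : ∀ n, SimpleGraph (V n)),
    (∃ d : ℕ, DegreeBound G d) → BSConvergent G →
      ∃ l : ℝ, Tendsto (fun n => p (V n) (G n)) atTop (𝓝 l)

/-- The integral of an extended-real-valued function, as the integral of the positive part minus
the integral of the negative part. -/
noncomputable def erealIntegral {Ω : Type*} [MeasurableSpace Ω] (μ : Measure Ω) (f : Ω → EReal) :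
    EReal :=
  ((∫⁻ x, (f x).toENNReal ∂μ : ℝ≥0∞) : EReal) - ((∫⁻ x, (-f x).toENNReal ∂μ : ℝ≥0∞) : EReal)

/-- The interval `[-2√(d-1), 2√(d-1)]`. -/
noncomputable def rootInterval (d : ℕ) : Set ℝ :=
  Set.Icc (-(2 * √((d : ℝ) - 1))) (2 * √((d : ℝ) - 1))

end MatchingBS

/-! Everything is read off from the roots of the matching polynomial. Write P_S for the matching
polynomial of G with the vertex set S deleted. Splitting matchings by the edge covering a vertex v
gives P_S = x P_{S+v} - ∑_u P_{S+v+u}, over the neighbours u of v outside S (`avoidingPoly_eq`).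
Divided by P_{S+v}, this is a continued fraction for ratios. It preserves the upper half-plane, so
all roots are real, and it keeps ratios positive for x > 2√(d-1), so all roots lie in K
(Heilmann–Lieb).

For weak convergence, P'/P = ∑_v P_{v}/P at a real x ≥ 2d+2. There the continued fraction contracts,
so its depth-k truncation, which depends only on the k-ball around v, is uniformly close to P_{v}/P
(`abs_truncatedRatio_sub_le`). Averages of local functions converge along a Benjamini–Schramm
convergent sequence, hence so do the resolvents ∫ 1/(x-r) for all large x. Letting x grow recovers
the moments, polynomial approximation gives every continuous test function, and compactness gives
the limit measure ρ.

For (a), evaluating at iy removes the signs: ∑_k m_k y^(v-2k) = ∏ (y²+r²)^(1/2). At y = 1 its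
logarithm and first two derivatives turn the number of matchings, the mean and the variance into
root averages of continuous functions. The matching number is the delicate case, since v - 2ν is the
multiplicity of the root 0 and an atom is not weakly continuous. Integrality helps: the lowest
nonzero coefficient is an integer, so the nonzero roots have absolute product at least 1. As they
are also bounded, only a fraction O(1/log k) can lie within 1/k of 0, uniformly in the graph
(`sum_tent_mul_log_le`).

For (b), pm is the absolute product of all roots. Truncating log |x| from below gives a continuous
upper bound; one passes to the limit in n and then removes the truncation by monotone convergence.
No such uniform control is available here, so only an inequality results. -/

namespace MatchingBS

/-! ### Matchings as edge sets, the deletion recursion, and extreme coefficients. -/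

section Combinatorics

variable {V : Type u} [Fintype V] (G : SimpleGraph V)

/-- A set of edges of `G` that are pairwise disjoint and contain no vertex of `S`. -/
structure IsMatchingAvoiding (S : Finset V) (F : Finset (Sym2 V)) : Prop where
  mem_edgeSet : ∀ e ∈ F, e ∈ G.edgeSet
  eq_of_mem : ∀ e ∈ F, ∀ e' ∈ F, ∀ v, v ∈ e → v ∈ e' → e = e'
  avoids : ∀ e ∈ F, ∀ v ∈ e, v ∉ S

open Classical in
/-- The matchings of `G` with no vertex in `S`, as sets of edges. -/
noncomputable def matchingsAvoiding (S : Finset V) : Finset (Finset (Sym2 V)) :=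
  Finset.univ.filter (IsMatchingAvoiding G S)

variable {G} in
theorem mem_matchingsAvoiding {S : Finset V} {F : Finset (Sym2 V)} :
    F ∈ matchingsAvoiding G S ↔ IsMatchingAvoiding G S F := by
  simp [matchingsAvoiding]

variable [DecidableEq V]

/-- The vertices covered by a set of edges. -/
def cover (F : Finset (Sym2 V)) : Finset V := Finset.univ.filter fun v => ∃ e ∈ F, v ∈ e

/-- The matching polynomial of the graph obtained from `G` by deleting the vertices in `S`. -/
noncomputable def avoidingPoly (S : Finset V) : ℝ[X] :=
  ∑ F ∈ matchingsAvoiding G S, C ((-1) ^ F.card) * X ^ (Sᶜ.card - 2 * F.card)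


variable {G}

theorem mem_cover {F : Finset (Sym2 V)} {v : V} : v ∈ cover F ↔ ∃ e ∈ F, v ∈ e := by
  simp [cover]

theorem IsMatchingAvoiding.card_cover {S : Finset V} {F : Finset (Sym2 V)}
    (h : IsMatchingAvoiding G S F) : (cover F).card = 2 * F.card := by
  have : cover F = F.biUnion fun e => e.toFinset := by
    ext v
    simp [mem_cover]
  rw [this, Finset.card_biUnion, Finset.sum_const_nat (m := 2), mul_comm]
  · intro e he
    exact Sym2.card_toFinset_of_not_isDiag e (G.not_isDiag_of_mem_edgeSet (h.mem_edgeSet e he))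
  · intro e he e' he' hne
    refine Finset.disjoint_left.2 fun v hv hv' => ?_
    exact hne (h.eq_of_mem e he e' he' v (by simpa using hv) (by simpa using hv'))

theorem IsMatchingAvoiding.cover_subset {S : Finset V} {F : Finset (Sym2 V)}
    (h : IsMatchingAvoiding G S F) : cover F ⊆ Sᶜ := by
  intro v hv
  obtain ⟨e, he, hve⟩ := mem_cover.1 hv
  simpa using h.avoids e he v hve

theorem IsMatchingAvoiding.two_mul_card_le {S : Finset V} {F : Finset (Sym2 V)}
    (h : IsMatchingAvoiding G S F) : 2 * F.card ≤ Sᶜ.card :=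
  h.card_cover ▸ Finset.card_le_card h.cover_subset

theorem isMatchingAvoiding_insert_iff {S : Finset V} {F : Finset (Sym2 V)} {v : V} :
    IsMatchingAvoiding G (insert v S) F ↔ IsMatchingAvoiding G S F ∧ v ∉ cover F := by
  constructor
  · intro h
    refine ⟨⟨h.1, h.2, fun e he w hw hwS => h.3 e he w hw (by simp [hwS])⟩, fun hv => ?_⟩
    obtain ⟨e, he, hve⟩ := mem_cover.1 hv
    exact h.3 e he v hve (by simp)
  · rintro ⟨h, hv⟩
    refine ⟨h.1, h.2, fun e he w hw hwS => ?_⟩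
    rcases Finset.mem_insert.1 hwS with rfl | hwS
    · exact hv (mem_cover.2 ⟨e, he, hw⟩)
    · exact h.3 e he w hw hwS

theorem IsMatchingAvoiding.insert_edge {S : Finset V} {F : Finset (Sym2 V)} {v u : V}
    (hvu : G.Adj v u) (hv : v ∉ S) (hu : u ∉ S)
    (h : IsMatchingAvoiding G (insert u (insert v S)) F) :
    IsMatchingAvoiding G S (insert s(v, u) F) := by
  obtain ⟨h, hu'⟩ := isMatchingAvoiding_insert_iff.1 h
  obtain ⟨h, hv'⟩ := isMatchingAvoiding_insert_iff.1 h
  have key : ∀ e ∈ F, ∀ w, w ∈ e → w ∉ s(v, u) := by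
    intro e he w hw hw'
    rcases Sym2.mem_iff.1 hw' with rfl | rfl
    · exact hv' (mem_cover.2 ⟨e, he, hw⟩)
    · exact hu' (mem_cover.2 ⟨e, he, hw⟩)
  refine ⟨fun e he => ?_, fun e he e' he' w hw hw' => ?_, fun e he w hw => ?_⟩
  · rcases Finset.mem_insert.1 he with rfl | he
    · exact hvu
    · exact h.1 e he
  · rcases Finset.mem_insert.1 he with rfl | he <;> rcases Finset.mem_insert.1 he' with rfl | he'
    · rfl
    · exact (key e' he' w hw' hw).elim
    · exact (key e he w hw hw').elim
    · exact h.2 e he e' he' w hw hw'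
  · rcases Finset.mem_insert.1 he with rfl | he
    · rcases Sym2.mem_iff.1 hw with rfl | rfl <;> assumption
    · exact h.3 e he w hw

theorem IsMatchingAvoiding.erase_edge {S : Finset V} {F : Finset (Sym2 V)} {v u : V}
    (h : IsMatchingAvoiding G S F) (hF : s(v, u) ∈ F) :
    IsMatchingAvoiding G (insert u (insert v S)) (F.erase s(v, u)) := by
  have key : ∀ w ∈ s(v, u), w ∉ cover (F.erase s(v, u)) := by
    intro w hw hw'
    obtain ⟨e, he, hwe⟩ := mem_cover.1 hw'
    exact (Finset.ne_of_mem_erase he)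
      (h.2 e (Finset.mem_of_mem_erase he) _ hF w hwe hw)
  refine isMatchingAvoiding_insert_iff.2 ⟨isMatchingAvoiding_insert_iff.2 ⟨⟨?_, ?_, ?_⟩,
    key v (by simp)⟩, key u (by simp)⟩
  · exact fun e he => h.1 e (Finset.mem_of_mem_erase he)
  · exact fun e he e' he' => h.2 e (Finset.mem_of_mem_erase he) e' (Finset.mem_of_mem_erase he')
  · exact fun e he => h.3 e (Finset.mem_of_mem_erase he)

open Classical in
variable (G) in
/-- The neighbours of `v` outside `S`. -/
noncomputable def freeNeighbors (S : Finset V) (v : V) : Finset V :=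
  Finset.univ.filter fun u => G.Adj v u ∧ u ∉ S

theorem mem_freeNeighbors {S : Finset V} {v u : V} :
    u ∈ freeNeighbors G S v ↔ G.Adj v u ∧ u ∉ S := by
  simp [freeNeighbors]

/-- A matching either misses v or contains exactly one edge vu; removing that edge is a bijection
onto the matchings that also avoid u and v. -/
theorem sum_matchingsAvoiding {A : Type*} [AddCommMonoid A] (w : Finset (Sym2 V) → A)
    {S : Finset V} {v : V} (hv : v ∉ S) :
    ∑ F ∈ matchingsAvoiding G S, w F = ∑ F ∈ matchingsAvoiding G (insert v S), w F +
      ∑ u ∈ freeNeighbors G S v, ∑ F ∈ matchingsAvoiding G (insert u (insert v S)),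
        w (insert s(v, u) F) := by
  have hnot : ∀ u, ∀ F ∈ matchingsAvoiding G (insert u (insert v S)), s(v, u) ∉ F := by
    intro u F hF hmem
    exact (mem_matchingsAvoiding.1 hF).avoids _ hmem v (by simp) (by simp)
  have hset : matchingsAvoiding G S = matchingsAvoiding G (insert v S) ∪
      (freeNeighbors G S v).biUnion fun u =>
        (matchingsAvoiding G (insert u (insert v S))).image (insert s(v, u)) := by
    ext F
    simp only [Finset.mem_union, Finset.mem_biUnion, Finset.mem_image, mem_matchingsAvoiding,
      mem_freeNeighbors]
    constructor
    · intro h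
      by_cases hc : v ∈ cover F
      · right
        obtain ⟨e, he, hve⟩ := mem_cover.1 hc
        obtain ⟨u, rfl⟩ := hve
        exact ⟨u, ⟨h.1 _ he, h.3 _ he u (by simp)⟩, F.erase s(v, u), h.erase_edge he,
          Finset.insert_erase he⟩
      · exact Or.inl (isMatchingAvoiding_insert_iff.2 ⟨h, hc⟩)
    · rintro (h | ⟨u, ⟨hadj, hu⟩, F', h, rfl⟩)
      · exact (isMatchingAvoiding_insert_iff.1 h).1
      · exact h.insert_edge hadj hv hu
  rw [hset, Finset.sum_union, Finset.sum_biUnion]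
  · congr 1
    refine Finset.sum_congr rfl fun u _ => Finset.sum_image ?_
    intro F hF F' hF' hFF
    rw [← Finset.erase_insert (hnot u F hF), ← Finset.erase_insert (hnot u F' hF')]
    exact congrArg (fun s => Finset.erase s s(v, u)) hFF
  · intro u hu u' hu' hne
    refine Finset.disjoint_left.2 fun F hF hF' => ?_
    obtain ⟨F₁, h₁, rfl⟩ := Finset.mem_image.1 hF
    obtain ⟨F₂, h₂, h₃⟩ := Finset.mem_image.1 hF'
    have hm := (mem_matchingsAvoiding.1 h₁).insert_edge (mem_freeNeighbors.1 hu).1 hv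
      (mem_freeNeighbors.1 hu).2
    have := hm.eq_of_mem s(v, u) (by simp) s(v, u') (by rw [← h₃]; simp) v (by simp) (by simp)
    exact hne (Sym2.congr_right.1 this)
  · refine Finset.disjoint_left.2 fun F hF hF' => ?_
    obtain ⟨u, -, hF'⟩ := Finset.mem_biUnion.1 hF'
    obtain ⟨F₁, h₁, rfl⟩ := Finset.mem_image.1 hF'
    exact (mem_matchingsAvoiding.1 hF).avoids s(v, u) (by simp) v (by simp) (by simp)

theorem card_compl_insert {S : Finset V} {v : V} (hv : v ∉ S) :
    Sᶜ.card = (insert v S)ᶜ.card + 1 := by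
  rw [Finset.compl_insert, Finset.card_erase_add_one (by simpa using hv)]

theorem avoidingPoly_eq {S : Finset V} {v : V} (hv : v ∉ S) :
    avoidingPoly G S = X * avoidingPoly G (insert v S) -
      ∑ u ∈ freeNeighbors G S v, avoidingPoly G (insert u (insert v S)) := by
  have hc := card_compl_insert hv
  rw [avoidingPoly, sum_matchingsAvoiding _ hv, sub_eq_add_neg, ← Finset.sum_neg_distrib]
  congr 1
  · rw [avoidingPoly, Finset.mul_sum]
    refine Finset.sum_congr rfl fun F hF => ?_
    -- Without this bound the natural-number subtraction in the exponent could truncate, and the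
    -- shift by one would fail.
    have := (mem_matchingsAvoiding.1 hF).two_mul_card_le
    rw [hc, show (insert v S)ᶜ.card + 1 - 2 * F.card = (insert v S)ᶜ.card - 2 * F.card + 1 by
      omega, pow_succ]
    ring
  · refine Finset.sum_congr rfl fun u hu => ?_
    rw [avoidingPoly, ← Finset.sum_neg_distrib]
    refine Finset.sum_congr rfl fun F hF => ?_
    have hu' : u ∉ insert v S := by
      simp [(mem_freeNeighbors.1 hu).2, (mem_freeNeighbors.1 hu).1.ne']
    have hc' := card_compl_insert hu'
    have hn : s(v, u) ∉ F := fun hmem =>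
      (mem_matchingsAvoiding.1 hF).avoids _ hmem v (by simp) (by simp)
    rw [Finset.card_insert_of_notMem hn, hc, hc', pow_succ,
      show (insert u (insert v S))ᶜ.card + 1 + 1 - 2 * (F.card + 1) =
        (insert u (insert v S))ᶜ.card - 2 * F.card by omega]
    simp

theorem avoidingPoly_univ : avoidingPoly G Finset.univ = 1 := by
  have : matchingsAvoiding G Finset.univ = {∅} := by
    ext F
    rw [mem_matchingsAvoiding, Finset.mem_singleton]
    constructor
    · intro h
      have := h.two_mul_card_le
      simpa using this
    · rintro rfl
      exact ⟨by simp, by simp, by simp⟩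
  simp [avoidingPoly, this]

/-- The exponent of the term of F is the number of vertices F leaves uncovered. Differentiation
therefore yields one copy of the term for each uncovered v, and such F are exactly the matchings
avoiding v. -/
theorem derivative_avoidingPoly :
    derivative (avoidingPoly G ∅) = ∑ v, avoidingPoly G {v} := by
  have hM : ∀ v : V, matchingsAvoiding G {v} =
      (matchingsAvoiding G ∅).filter fun F => v ∉ cover F := by
    intro v
    ext F
    rw [Finset.mem_filter, mem_matchingsAvoiding, mem_matchingsAvoiding,
      ← isMatchingAvoiding_insert_iff]
    simp
  simp only [avoidingPoly, hM, Finset.sum_filter, derivative_sum]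
  rw [Finset.sum_comm]
  refine Finset.sum_congr rfl fun F hF => ?_
  have hF' := mem_matchingsAvoiding.1 hF
  rw [← Finset.sum_filter, derivative_C_mul_X_pow]
  have hcard : (Finset.univ.filter fun v => v ∉ cover F).card =
      (∅ : Finset V)ᶜ.card - 2 * F.card := by
    rw [← hF'.card_cover, ← Finset.card_sdiff_of_subset (by simp)]
    congr 1
    ext v
    simp
  rw [Finset.sum_congr rfl (g := fun _ => C ((-1 : ℝ) ^ F.card) *
    X ^ ((∅ : Finset V)ᶜ.card - 2 * F.card - 1)), Finset.sum_const, hcard, nsmul_eq_mul, C_mul,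
    ← map_natCast (C : ℝ →+* ℝ[X])]
  · ring
  · intro v _
    rw [card_compl_insert (S := ∅) (v := v) (by simp), Nat.sub_right_comm]
    simp

/-- Matchings as subgraphs correspond to matchings as sets of edges. -/
noncomputable def matchingEquiv :
    {M : G.Subgraph // M.IsMatching} ≃ {F // F ∈ matchingsAvoiding G ∅} := by
  classical
  exact {
  toFun M := ⟨M.1.edgeSet.toFinset, mem_matchingsAvoiding.2 ⟨
    fun e he => M.1.edgeSet_subset (by simpa using he),
    fun e he e' he' v hv hv' => by
      obtain ⟨a, rfl⟩ := hv
      obtain ⟨b, rfl⟩ := hv'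
      rw [M.2.eq_of_adj_left (show M.1.Adj v a by simpa using he)
        (show M.1.Adj v b by simpa using he')],
    by simp⟩⟩
  invFun F :=
    have hF := mem_matchingsAvoiding.1 F.2
    ⟨{ verts := {v | v ∈ cover F.1}
       Adj a b := s(a, b) ∈ F.1
       adj_sub := fun h => hF.mem_edgeSet _ h
       edge_vert := fun h => mem_cover.2 ⟨_, h, by simp⟩
       symm := ⟨fun a b h => by rwa [Sym2.eq_swap]⟩ }, by
      intro v hv
      obtain ⟨e, he, u, rfl⟩ := mem_cover.1 hv
      refine ⟨u, he, fun w hw => ?_⟩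
      exact Sym2.congr_right.1 (hF.eq_of_mem s(v, w) hw s(v, u) he v (by simp) (by simp))⟩
  left_inv M := by
    ext a b
    · simp only [Set.mem_ofPred_eq, mem_cover]
      constructor
      · rintro ⟨e, he, u, rfl⟩
        exact M.1.edge_vert (show M.1.Adj a u by simpa using he)
      · intro ha
        obtain ⟨u, hu, -⟩ := M.2 ha
        exact ⟨s(a, u), by simpa using hu, by simp⟩
    · simp
  right_inv F := by
    ext e
    induction e with | _ a b => simp }

theorem card_matchingEquiv (M : {M : G.Subgraph // M.IsMatching}) :
    (matchingEquiv M).1.card = M.1.edgeSet.ncard := by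
  classical
  rw [Set.ncard_eq_toFinset_card']
  simp only [matchingEquiv, Equiv.coe_fn_mk]

theorem cover_matchingEquiv (M : {M : G.Subgraph // M.IsMatching}) (v : V) :
    v ∈ cover (matchingEquiv M).1 ↔ v ∈ M.1.verts := by
  conv_rhs => rw [← matchingEquiv.symm_apply_apply M]
  rfl

variable (G)

theorem card_isMatching_and (p : G.Subgraph → Prop) (q : Finset (Sym2 V) → Prop)
    [DecidablePred q] (h : ∀ M : {M : G.Subgraph // M.IsMatching}, p M.1 ↔ q (matchingEquiv M).1) :
    Nat.card {M : G.Subgraph // M.IsMatching ∧ p M} =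
      ((matchingsAvoiding G ∅).filter q).card := by
  rw [← Nat.card_congr (Equiv.subtypeSubtypeEquivSubtypeInter _ p),
    Nat.card_congr (matchingEquiv.subtypeEquiv (q := fun F => q F.1) h),
    Nat.card_congr (Equiv.subtypeSubtypeEquivSubtypeInter _ q), ← Nat.card_eq_finsetCard]
  exact Nat.card_congr (Equiv.subtypeEquivRight fun F => by simp)

theorem numMatchingsOfSize_eq (k : ℕ) :
    numMatchingsOfSize G k = ((matchingsAvoiding G ∅).filter fun F => F.card = k).card :=
  card_isMatching_and G _ _ fun M => by rw [card_matchingEquiv]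

theorem numMatchings_eq : numMatchings G = (matchingsAvoiding G ∅).card := by
  rw [numMatchings, Nat.card_congr matchingEquiv, Nat.card_eq_fintype_card, Fintype.card_coe]

theorem numPerfectMatchings_eq : numPerfectMatchings G =
    ((matchingsAvoiding G ∅).filter fun F => 2 * F.card = Fintype.card V).card := by
  refine card_isMatching_and G _ _ fun M => ?_
  rw [← (mem_matchingsAvoiding.1 (matchingEquiv M).2).card_cover, Finset.card_eq_iff_eq_univ,
    Finset.eq_univ_iff_forall]
  exact forall_congr' fun v => (cover_matchingEquiv M v).symm

theorem card_le_of_mem {F : Finset (Sym2 V)} (hF : F ∈ matchingsAvoiding G ∅) :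
    F.card ∈ Finset.range (Fintype.card V / 2 + 1) := by
  have := (mem_matchingsAvoiding.1 hF).two_mul_card_le
  rw [Finset.compl_empty, Finset.card_univ] at this
  rw [Finset.mem_range]
  omega

theorem sum_numMatchingsOfSize (f : ℕ → ℝ) :
    ∑ k ∈ Finset.range (Nat.card V / 2 + 1), f k * numMatchingsOfSize G k =
      ∑ F ∈ matchingsAvoiding G ∅, f F.card := by
  rw [Nat.card_eq_fintype_card, ← Finset.sum_fiberwise_of_maps_to fun F hF => card_le_of_mem G hF]
  refine Finset.sum_congr rfl fun k _ => ?_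
  rw [Finset.sum_congr rfl (g := fun _ => f k), Finset.sum_const, numMatchingsOfSize_eq,
    nsmul_eq_mul, mul_comm]
  intro F hF
  rw [(Finset.mem_filter.1 hF).2]

theorem matchingPoly_eq : matchingPoly G = avoidingPoly G ∅ := by
  rw [avoidingPoly, ← Finset.sum_fiberwise_of_maps_to fun F hF => card_le_of_mem G hF,
    matchingPoly, Nat.card_eq_fintype_card]
  refine Finset.sum_congr rfl fun k _ => ?_
  rw [Finset.sum_congr rfl (g := fun _ => C ((-1 : ℝ) ^ k) * X ^ (Fintype.card V - 2 * k)),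
    Finset.sum_const, numMatchingsOfSize_eq, nsmul_eq_mul, C_mul, map_natCast]
  · ring
  · intro F hF
    rw [(Finset.mem_filter.1 hF).2]
    simp

theorem exists_card_eq_matchingNumber :
    ∃ F ∈ matchingsAvoiding G ∅, F.card = matchingNumber G := by
  have : matchingNumber G ∈ {k : ℕ | ∃ M : G.Subgraph, M.IsMatching ∧ M.edgeSet.ncard = k} := by
    -- On ℕ the supremum is attained only for a nonempty bounded set; an unbounded one would have
    -- supremum 0 by default.
    refine Nat.sSup_mem ⟨_, ⊥, fun v hv => hv.elim, rfl⟩ ⟨Fintype.card V / 2, ?_⟩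
    rintro _ ⟨M, hM, rfl⟩
    rw [← card_matchingEquiv ⟨M, hM⟩]
    exact Nat.lt_succ_iff.1 (Finset.mem_range.1 (card_le_of_mem G (matchingEquiv ⟨M, hM⟩).2))
  obtain ⟨M, hM, h⟩ := this
  exact ⟨_, (matchingEquiv ⟨M, hM⟩).2, (card_matchingEquiv ⟨M, hM⟩).trans h⟩

theorem card_le_matchingNumber {F : Finset (Sym2 V)} (hF : F ∈ matchingsAvoiding G ∅) :
    F.card ≤ matchingNumber G := by
  refine le_csSup ⟨Fintype.card V / 2, ?_⟩ ⟨(matchingEquiv.symm ⟨F, hF⟩).1,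
    (matchingEquiv.symm ⟨F, hF⟩).2, ?_⟩
  · rintro _ ⟨M, hM, rfl⟩
    rw [← card_matchingEquiv ⟨M, hM⟩]
    exact Nat.lt_succ_iff.1 (Finset.mem_range.1 (card_le_of_mem G (matchingEquiv ⟨M, hM⟩).2))
  · rw [← card_matchingEquiv, Equiv.apply_symm_apply]

theorem two_mul_matchingNumber_le : 2 * matchingNumber G ≤ Fintype.card V := by
  obtain ⟨F, hF, h⟩ := exists_card_eq_matchingNumber G
  have := (mem_matchingsAvoiding.1 hF).two_mul_card_le
  rwa [Finset.compl_empty, Finset.card_univ, h] at this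

/-- The lowest power of x comes from the maximum matchings, and its coefficient is up to sign their
number. That this is a positive integer, hence at least 1, is the integrality input behind the
convergence of ν/v. -/
theorem natTrailingDegree_matchingPoly :
    (matchingPoly G).natTrailingDegree = Fintype.card V - 2 * matchingNumber G ∧
      1 ≤ |(matchingPoly G).trailingCoeff| := by
  have h2 := two_mul_matchingNumber_le G
  have hco : (matchingPoly G).coeff (Fintype.card V - 2 * matchingNumber G) =
      (-1) ^ matchingNumber G * numMatchingsOfSize G (matchingNumber G) := by
    rw [matchingPoly, finsetSum_coeff, Finset.sum_eq_single (matchingNumber G)]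
    · rw [Nat.card_eq_fintype_card, coeff_C_mul_X_pow, if_pos rfl]
    · intro k hk hne
      rw [Nat.card_eq_fintype_card] at hk ⊢
      have := Finset.mem_range.1 hk
      rw [coeff_C_mul_X_pow, if_neg (by omega)]
    · intro h
      rw [Nat.card_eq_fintype_card, Finset.mem_range] at h
      omega
  have hm : 1 ≤ numMatchingsOfSize G (matchingNumber G) := by
    obtain ⟨F, hF, h⟩ := exists_card_eq_matchingNumber G
    rw [numMatchingsOfSize_eq]
    exact Finset.card_pos.2 ⟨F, Finset.mem_filter.2 ⟨hF, h⟩⟩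
  have hdeg : (matchingPoly G).natTrailingDegree = Fintype.card V - 2 * matchingNumber G := by
    apply le_antisymm
    · apply natTrailingDegree_le_of_ne_zero
      rw [hco]
      exact mul_ne_zero (by simp) (by exact_mod_cast Nat.one_le_iff_ne_zero.1 hm)
    · apply le_natTrailingDegree
      · intro h
        have := matchingPoly_coeff_card G
        simp [h] at this
      · intro k hk
        rw [matchingPoly_eq, avoidingPoly, finsetSum_coeff]
        refine Finset.sum_eq_zero fun F hF => ?_
        have := card_le_matchingNumber G hF
        rw [coeff_C_mul_X_pow, if_neg]
        rw [Finset.compl_empty, Finset.card_univ]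
        omega
  refine ⟨hdeg, ?_⟩
  rw [trailingCoeff, hdeg, hco, abs_mul, abs_pow, abs_neg, abs_one, one_pow, one_mul, Nat.abs_cast]
  exact_mod_cast hm

/-- Only perfect matchings contribute a constant term, and all of them carry the same sign. -/
theorem abs_eval_zero_matchingPoly :
    |(matchingPoly G).eval 0| = numPerfectMatchings G := by
  have : (matchingPoly G).eval 0 = (-1) ^ (Fintype.card V / 2) * numPerfectMatchings G := by
    rw [matchingPoly_eq, avoidingPoly, eval_finsetSum, numPerfectMatchings_eq,
      Finset.card_filter, Nat.cast_sum, Finset.mul_sum]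
    refine Finset.sum_congr rfl fun F hF => ?_
    have := (mem_matchingsAvoiding.1 hF).two_mul_card_le
    rw [Finset.compl_empty, Finset.card_univ] at this ⊢
    split_ifs with h
    · simp [← h]
    · have : Fintype.card V - 2 * F.card ≠ 0 := by omega
      simp [this]
  rw [this, abs_mul, abs_pow, abs_neg, abs_one, one_pow, one_mul, Nat.abs_cast]

end Combinatorics

/-! ### The Heilmann–Lieb theorem: real roots, bounded by 2√(d-1). -/

section HeilmannLieb

variable {V : Type u} [Fintype V] [DecidableEq V] {G : SimpleGraph V}

/-- Induction on the set of deleted vertices, from larger to smaller sets. -/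
theorem deletion_induction {p : Finset V → Prop}
    (h : ∀ S, (∀ T, S ⊂ T → p T) → p S) (S : Finset V) : p S := by
  induction hn : Sᶜ.card using Nat.strong_induction_on generalizing S with
  | _ n ih =>
    subst hn
    exact h S fun T hT => ih _ (Finset.card_lt_card (compl_lt_compl_iff_lt.2 hT)) T rfl

/-- The ratio P_S/P_{S+v} equals z minus reciprocals of earlier ratios. Inversion sends the upper
half-plane to the lower one, so the imaginary part stays positive, and a ratio with positive
imaginary part has nonzero numerator. Both claims are carried together because each step divides by
the earlier polynomials. -/
theorem aeval_avoidingPoly_ne_zero_of_im_pos {z : ℂ} (hz : 0 < z.im) (S : Finset V) :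
    aeval z (avoidingPoly G S) ≠ 0 ∧ ∀ v ∉ S,
      0 < (aeval z (avoidingPoly G S) / aeval z (avoidingPoly G (insert v S))).im := by
  induction S using deletion_induction with
  | h S ih =>
    have key : ∀ v ∉ S,
        0 < (aeval z (avoidingPoly G S) / aeval z (avoidingPoly G (insert v S))).im := by
      intro v hv
      have h0 := (ih (insert v S) (Finset.ssubset_insert hv)).1
      rw [avoidingPoly_eq hv, map_sub, map_mul, aeval_X, sub_div, mul_div_cancel_right₀ _ h0,
        map_sum, Finset.sum_div, Complex.sub_im, Complex.im_sum, sub_pos]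
      refine lt_of_le_of_lt (Finset.sum_nonpos fun u hu => ?_) hz
      have hu' : u ∉ insert v S := by
        simp [(mem_freeNeighbors.1 hu).2, (mem_freeNeighbors.1 hu).1.ne']
      have := (ih (insert v S) (Finset.ssubset_insert hv)).2 u hu'
      rw [← inv_div, Complex.inv_im]
      exact div_nonpos_of_nonpos_of_nonneg (by linarith) (Complex.normSq_nonneg _)
    refine ⟨?_, key⟩
    by_cases hS : S = Finset.univ
    · simp [hS, avoidingPoly_univ]
    · obtain ⟨v, hv⟩ : ∃ v, v ∉ S := by
        by_contra! h
        exact hS (Finset.eq_univ_iff_forall.2 h)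
      intro h0
      have := key v hv
      simp [h0] at this

theorem im_eq_zero_of_aeval_avoidingPoly_eq_zero {S : Finset V} {z : ℂ}
    (h : aeval z (avoidingPoly G S) = 0) : z.im = 0 := by
  rcases lt_trichotomy z.im 0 with hz | hz | hz
  · refine ((aeval_avoidingPoly_ne_zero_of_im_pos (G := G) (z := starRingEnd ℂ z)
      (by simpa using hz) S).1 ?_).elim
    rw [aeval_conj, h, map_zero]
  · exact hz
  · exact ((aeval_avoidingPoly_ne_zero_of_im_pos hz S).1 h).elim

theorem freeNeighbors_anti {S T : Finset V} (h : S ⊆ T) (v : V) :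
    freeNeighbors G T v ⊆ freeNeighbors G S v := by
  intro u hu
  obtain ⟨h1, h2⟩ := mem_freeNeighbors.1 hu
  exact mem_freeNeighbors.2 ⟨h1, fun h3 => h2 (h h3)⟩

theorem card_freeNeighbors_lt {S : Finset V} {v u : V} (hv : v ∉ S)
    (hu : u ∈ freeNeighbors G S v) :
    (freeNeighbors G (insert v S) u).card < (freeNeighbors G S u).card := by
  refine Finset.card_lt_card ⟨freeNeighbors_anti (Finset.subset_insert v S) u, fun h => ?_⟩
  have hv' : v ∈ freeNeighbors G S u := mem_freeNeighbors.2 ⟨(mem_freeNeighbors.1 hu).1.symm, hv⟩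
  exact (mem_freeNeighbors.1 (h hv')).2 (by simp)

/-- With s = √(d-1), the invariant is P_S/P_{S+v} ≥ s at vertices with at most d-1 free neighbours.
It propagates because x - (d-1)/s ≥ 2s - s = s, and because a neighbour of a freshly deleted vertex
has lost one of its at most d neighbours. A first vertex may have all d neighbours, so there only
positivity is claimed. -/
theorem eval_avoidingPoly_pos {d : ℕ} (hd : 2 ≤ d)
    (hG : ∀ v, (freeNeighbors G ∅ v).card ≤ d) {x : ℝ} (hx : 2 * √((d : ℝ) - 1) < x)
    (S : Finset V) : 0 < (avoidingPoly G S).eval x ∧ ∀ v ∉ S, (freeNeighbors G S v).card < d →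
      √((d : ℝ) - 1) * (avoidingPoly G (insert v S)).eval x ≤ (avoidingPoly G S).eval x := by
  set s := √((d : ℝ) - 1) with hs
  have hd' : (2 : ℝ) ≤ d := by exact_mod_cast hd
  have hs0 : 0 < s := Real.sqrt_pos.2 (by linarith)
  have hss : s * s = d - 1 := Real.mul_self_sqrt (by linarith)
  have hG' : ∀ S v, (freeNeighbors G S v).card ≤ d := fun S v =>
    (Finset.card_le_card (freeNeighbors_anti (Finset.empty_subset S) v)).trans (hG v)
  induction S using deletion_induction with
  | h S ih =>
    have key : ∀ v ∉ S, s * (x * (avoidingPoly G (insert v S)).eval x -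
        (avoidingPoly G S).eval x) ≤
        (freeNeighbors G S v).card * (avoidingPoly G (insert v S)).eval x := by
      intro v hv
      rw [avoidingPoly_eq hv, eval_sub, eval_mul, eval_X, sub_sub_cancel, eval_finsetSum,
        Finset.mul_sum, ← nsmul_eq_mul]
      refine Finset.sum_le_card_nsmul _ _ _ fun u hu => ?_
      have hu' : u ∉ insert v S := by
        simp [(mem_freeNeighbors.1 hu).2, (mem_freeNeighbors.1 hu).1.ne']
      exact (ih (insert v S) (Finset.ssubset_insert hv)).2 u hu'
        ((card_freeNeighbors_lt hv hu).trans_le (hG' S u))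
    constructor
    · by_cases hS : S = Finset.univ
      · simp [hS, avoidingPoly_univ]
      · obtain ⟨v, hv⟩ : ∃ v, v ∉ S := by
          by_contra! h
          exact hS (Finset.eq_univ_iff_forall.2 h)
        have hp := (ih (insert v S) (Finset.ssubset_insert hv)).1
        have hc : ((freeNeighbors G S v).card : ℝ) ≤ d := by exact_mod_cast hG' S v
        have h1 := key v hv
        have h2 := mul_le_mul_of_nonneg_right hc hp.le
        -- From s·x > 2s² = 2(d-1), which is at least d because d ≥ 2.
        have h3 : (d : ℝ) < s * x := by nlinarith
        have h4 := mul_lt_mul_of_pos_right h3 hp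
        have : 0 < s * (avoidingPoly G S).eval x := by linarith
        exact pos_of_mul_pos_right this hs0.le
    · intro v hv hdeg
      have hp := (ih (insert v S) (Finset.ssubset_insert hv)).1
      have hc : ((freeNeighbors G S v).card : ℝ) ≤ d - 1 := by
        have : ((freeNeighbors G S v).card : ℝ) + 1 ≤ d := by exact_mod_cast hdeg
        linarith
      have h1 := key v hv
      have h2 := mul_le_mul_of_nonneg_right hc hp.le
      have h4 := mul_le_mul_of_nonneg_right (mul_lt_mul_of_pos_left hx hs0).le hp.le
      refine le_of_mul_le_mul_left ?_ hs0
      nlinarith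

theorem eval_neg_avoidingPoly (S : Finset V) (x : ℝ) :
    (avoidingPoly G S).eval (-x) = (-1) ^ Sᶜ.card * (avoidingPoly G S).eval x := by
  simp only [avoidingPoly, eval_finsetSum, Finset.mul_sum, eval_mul, eval_C, eval_pow, eval_X]
  refine Finset.sum_congr rfl fun F hF => ?_
  have := (mem_matchingsAvoiding.1 hF).two_mul_card_le
  obtain ⟨k, hk⟩ := Nat.exists_eq_add_of_le this
  rw [hk, Nat.add_sub_cancel_left, neg_pow x, pow_add, pow_mul]
  simp
  ring

theorem mem_rootInterval_of_eval_eq_zero {d : ℕ} (hd : 2 ≤ d)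
    (hG : ∀ v, (freeNeighbors G ∅ v).card ≤ d) {S : Finset V} {x : ℝ}
    (h : (avoidingPoly G S).eval x = 0) : x ∈ rootInterval d := by
  constructor
  · by_contra! hx
    have := (eval_avoidingPoly_pos hd hG (x := -x) (by linarith) S).1
    rw [eval_neg_avoidingPoly, h, mul_zero] at this
    exact this.false
  · by_contra! hx
    exact (eval_avoidingPoly_pos hd hG hx S).1.ne' h

variable (G) in
/-- The real roots of the matching polynomial, with multiplicity. -/
noncomputable def matchingRoots : Multiset ℝ := (matchingPoly G).roots

omit [DecidableEq V] in
variable (G) in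
theorem matchingPoly_monic : (matchingPoly G).Monic := by
  rw [Monic, leadingCoeff, matchingPoly_natDegree, matchingPoly_coeff_card]

variable (G) in
theorem matchingPoly_splits : (matchingPoly G).Splits := by
  refine Splits.of_splits_map (algebraMap ℝ ℂ) (IsAlgClosed.splits _) fun z hz => ?_
  have hz' : aeval z (avoidingPoly G ∅) = 0 := by
    rw [← matchingPoly_eq]
    exact (mem_aroots'.1 hz).2
  exact ⟨z.re, Complex.ext rfl (im_eq_zero_of_aeval_avoidingPoly_eq_zero hz').symm⟩

variable (G) in
theorem card_matchingRoots : (matchingRoots G).card = Fintype.card V := by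
  rw [matchingRoots, ← (matchingPoly_splits G).natDegree_eq_card_roots, matchingPoly_natDegree,
    Nat.card_eq_fintype_card]

variable (G) in
theorem aroots_matchingPoly :
    (matchingPoly G).aroots ℂ = (matchingRoots G).map Complex.ofReal := by
  exact ((matchingPoly_splits G).roots_map (algebraMap ℝ ℂ))

variable (G) in
theorem aeval_matchingPoly {A : Type*} [CommRing A] [Algebra ℝ A] (z : A) :
    aeval z (matchingPoly G) = ((matchingRoots G).map fun r => z - algebraMap ℝ A r).prod := by
  conv_lhs => rw [(matchingPoly_splits G).eq_prod_roots_of_monic (matchingPoly_monic G)]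
  rw [map_multiset_prod, Multiset.map_map]
  simp [matchingRoots]

theorem mem_rootInterval_of_mem {d : ℕ} (hd : 2 ≤ d)
    (hG : ∀ v, (freeNeighbors G ∅ v).card ≤ d) {r : ℝ} (hr : r ∈ matchingRoots G) :
    r ∈ rootInterval d := by
  refine mem_rootInterval_of_eval_eq_zero hd hG (S := ∅) ?_
  rw [← matchingPoly_eq]
  exact (mem_roots'.1 hr).2

end HeilmannLieb

/-! ### Convergence by uniform approximation. -/

section Limits

/-- A sequence that is uniformly approximated by convergent sequences converges. -/
theorem exists_tendsto_of_approx {a : ℕ → ℝ}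
    (h : ∀ ε > 0, ∃ b : ℕ → ℝ, (∀ n, |a n - b n| ≤ ε) ∧ ∃ l, Tendsto b atTop (𝓝 l)) :
    ∃ l, Tendsto a atTop (𝓝 l) := by
  refine cauchySeq_tendsto_of_complete (Metric.cauchySeq_iff'.2 fun ε hε => ?_)
  obtain ⟨b, hb, l, hl⟩ := h (ε / 4) (by linarith)
  obtain ⟨N, hN⟩ := Metric.cauchySeq_iff'.1 hl.cauchySeq (ε / 4) (by linarith)
  refine ⟨N, fun n hn => ?_⟩
  have h1 := abs_le.1 (hb n)
  have h2 := abs_le.1 (hb N)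
  have h3 := abs_lt.1 (hN n hn)
  rw [Real.dist_eq, abs_lt]
  constructor <;> linarith

end Limits

/-! ### The truncated continued fraction sees only a ball. -/

section Locality

/-- The depth-`k` truncation of the continued-fraction recursion for the ratio of the matching
polynomials of `G - S - v` and `G - S` at `x`. -/
noncomputable def truncatedRatio (x : ℝ) : ℕ → ∀ {V : Type u}, SimpleGraph V → Set V → V → ℝ
  | 0, _, _, _, _ => 0
  | k + 1, _, G, S, v =>
    (x - ∑ᶠ u ∈ {u | G.Adj v u ∧ u ∉ S}, truncatedRatio x k G (insert v S) u)⁻¹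

/-- Each level of the recursion moves along one edge, so depth k never leaves the k-ball; an induced
copy containing that ball gives the same value. It serves both for the inclusion of the ball in G
and for its isomorphism with the model graph. -/
theorem truncatedRatio_embedding (x : ℝ) (k : ℕ) {W : Type*} {V : Type u} {H : SimpleGraph W}
    {G : SimpleGraph V} (f : H ↪g G) (S : Set V) (w : W)
    (h : ∀ u, G.edist (f w) u ≤ k → u ∈ Set.range f) :
    truncatedRatio x k H (f ⁻¹' S) w = truncatedRatio x k G S (f w) := by
  induction k generalizing S w with
  | zero => rfl
  | succ k ih =>
    simp only [truncatedRatio]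
    have hset : {u | G.Adj (f w) u ∧ u ∉ S} = f '' {u | H.Adj w u ∧ u ∉ f ⁻¹' S} := by
      ext u
      constructor
      · rintro ⟨hu, huS⟩
        obtain ⟨u', rfl⟩ := h u (by
          rw [SimpleGraph.edist_eq_one_iff_adj.2 hu]
          exact_mod_cast Nat.le_add_left 1 k)
        exact ⟨u', ⟨f.map_adj_iff.1 hu, huS⟩, rfl⟩
      · rintro ⟨u', ⟨hu, huS⟩, rfl⟩
        exact ⟨f.map_adj_iff.2 hu, huS⟩
    rw [hset, finsum_mem_image f.injective.injOn]
    congr 2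
    refine finsum_mem_congr rfl fun u hu => ?_
    rw [← ih (insert (f w) S) u]
    · congr 1
      ext y
      simp [f.injective.eq_iff]
    · intro y hy
      apply h
      calc G.edist (f w) y ≤ G.edist (f w) (f u) + G.edist (f u) y := SimpleGraph.edist_triangle
        _ ≤ 1 + k := by
          refine add_le_add (SimpleGraph.edist_eq_one_iff_adj.2 (f.map_adj_iff.2 hu.1)).le hy
        _ = (k + 1 : ℕ) := by push_cast; ring

theorem BallIso.truncatedRatio_eq {x : ℝ} {k : ℕ} {V : Type u} {W : Type*} {G : SimpleGraph V}
    {v : V}    {α : SimpleGraph W} {o : W} (h : BallIso G v k α o) :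
    truncatedRatio x k G ∅ v = truncatedRatio x k α ∅ o := by
  obtain ⟨φ, hφ⟩ := h
  have h1 := truncatedRatio_embedding x k (SimpleGraph.Embedding.induce (ballSet G v k)) ∅
    (ballCenter G v k) (fun u hu => ⟨⟨u, hu⟩, rfl⟩)
  have h2 := truncatedRatio_embedding x k φ.toEmbedding ∅ (ballCenter G v k)
    (fun u _ => φ.surjective u)
  rw [Set.preimage_empty] at h1 h2
  have h3 : φ.toEmbedding (ballCenter G v k) = o := hφ
  rw [h3] at h2
  exact h1.symm.trans h2

end Locality

/-! ### Contraction of the continued fraction at large real x. -/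

section Ratio

variable {V : Type u} [Fintype V] [DecidableEq V] {G : SimpleGraph V}

theorem truncatedRatio_succ (x : ℝ) (k : ℕ) (S : Finset V) (v : V) :
    truncatedRatio x (k + 1) G S v =
      (x - ∑ u ∈ freeNeighbors G S v,
        truncatedRatio x k G ((insert v S : Finset V) : Set V) u)⁻¹ := by
  have : {u | G.Adj v u ∧ u ∉ (S : Set V)} = (freeNeighbors G S v : Set V) := by
    ext u
    simp [mem_freeNeighbors]
  rw [truncatedRatio, this, finsum_mem_coe_finset, Finset.coe_insert]

/-- Inductively each of the at most d subtracted ratios is at most 1, so P_S/P_{S+v} ≥ x - d ≥ 1. -/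
theorem avoidingPoly_insert_le {d : ℕ} (hd : 2 ≤ d)
    (hG : ∀ v, (freeNeighbors G ∅ v).card ≤ d) {x : ℝ} (hx : d + 2 ≤ x) (S : Finset V) :
    0 < (avoidingPoly G S).eval x ∧ ∀ v ∉ S,
      (avoidingPoly G (insert v S)).eval x ≤ (avoidingPoly G S).eval x := by
  have hd' : (2 : ℝ) ≤ d := by exact_mod_cast hd
  have hpos : ∀ T : Finset V, 0 < (avoidingPoly G T).eval x := fun T =>
    (eval_avoidingPoly_pos hd hG (x := x) (by
      -- This is (d-2)² ≥ 0; it places x beyond the Heilmann–Lieb bound.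
      have : √((d : ℝ) - 1) ≤ d / 2 := Real.sqrt_le_iff.2 ⟨by linarith, by nlinarith⟩
      linarith) T).1
  refine ⟨hpos S, ?_⟩
  induction S using deletion_induction with
  | h S ih =>
    intro v hv
    have h1 : ∑ u ∈ freeNeighbors G S v, (avoidingPoly G (insert u (insert v S))).eval x ≤
        (freeNeighbors G S v).card • (avoidingPoly G (insert v S)).eval x := by
      refine Finset.sum_le_card_nsmul _ _ _ fun u hu => ?_
      have hu' : u ∉ insert v S := by
        simp [(mem_freeNeighbors.1 hu).2, (mem_freeNeighbors.1 hu).1.ne']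
      exact ih (insert v S) (Finset.ssubset_insert hv) u hu'
    have h2 : ((freeNeighbors G S v).card : ℝ) ≤ d := by
      exact_mod_cast (Finset.card_le_card
        (freeNeighbors_anti (Finset.empty_subset S) v)).trans (hG v)
    rw [nsmul_eq_mul] at h1
    rw [avoidingPoly_eq hv, eval_sub, eval_mul, eval_X, eval_finsetSum]
    nlinarith [hpos (insert v S)]

theorem ratio_eq {S : Finset V} {v : V} (hv : v ∉ S) {x : ℝ}
    (h : (avoidingPoly G (insert v S)).eval x ≠ 0) :
    (avoidingPoly G (insert v S)).eval x / (avoidingPoly G S).eval x =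
      (x - ∑ u ∈ freeNeighbors G S v, (avoidingPoly G (insert u (insert v S))).eval x /
        (avoidingPoly G (insert v S)).eval x)⁻¹ := by
  rw [avoidingPoly_eq hv, eval_sub, eval_mul, eval_X, eval_finsetSum, ← Finset.sum_div,
    ← inv_div]
  congr 1
  field_simp

theorem truncatedRatio_mem {d : ℕ} (hG : ∀ v, (freeNeighbors G ∅ v).card ≤ d) {x : ℝ}
    (hx : d + 2 ≤ x) (k : ℕ) (S : Finset V) (v : V) :
    truncatedRatio x k G S v ∈ Set.Icc 0 1 := by
  induction k generalizing S v with
  | zero => simp [truncatedRatio]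
  | succ k ih =>
    have h1 : ∑ u ∈ freeNeighbors G S v, truncatedRatio x k G ((insert v S : Finset V) : Set V) u ≤
        (freeNeighbors G S v).card • (1 : ℝ) :=
      Finset.sum_le_card_nsmul _ _ _ fun u _ => (ih _ u).2
    have h2 : ((freeNeighbors G S v).card : ℝ) ≤ d := by
      exact_mod_cast (Finset.card_le_card
        (freeNeighbors_anti (Finset.empty_subset S) v)).trans (hG v)
    rw [nsmul_eq_mul, mul_one] at h1
    rw [truncatedRatio_succ]
    exact ⟨inv_nonneg.2 (by linarith), inv_le_one_of_one_le₀ (by linarith)⟩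

/-- One level multiplies the error by at most d, from summing over neighbours, and divides it by a
product of two denominators. Both are at least x - d ≥ d + 2, so that product is at least 2d and the
error is halved. -/
theorem abs_truncatedRatio_sub_le {d : ℕ} (hd : 2 ≤ d)
    (hG : ∀ v, (freeNeighbors G ∅ v).card ≤ d) {x : ℝ} (hx : 2 * d + 2 ≤ x) (k : ℕ)
    (S : Finset V) (v : V) (hv : v ∉ S) :
    |truncatedRatio x k G S v -
      (avoidingPoly G (insert v S)).eval x / (avoidingPoly G S).eval x| ≤ (1 / 2) ^ k := by
  have hd' : (2 : ℝ) ≤ d := by exact_mod_cast hd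
  have hx' : (d : ℝ) + 2 ≤ x := by linarith
  have hP := avoidingPoly_insert_le hd hG hx'
  induction k generalizing S v with
  | zero =>
    rw [truncatedRatio, zero_sub, abs_neg, pow_zero,
      abs_of_nonneg (div_nonneg (hP _).1.le (hP _).1.le)]
    exact div_le_one_of_le₀ ((hP S).2 v hv) (hP _).1.le
  | succ k ih =>
    have h2 : ((freeNeighbors G S v).card : ℝ) ≤ d := by
      exact_mod_cast (Finset.card_le_card
        (freeNeighbors_anti (Finset.empty_subset S) v)).trans (hG v)
    have hu' : ∀ u ∈ freeNeighbors G S v, u ∉ insert v S := fun u hu => by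
      simp [(mem_freeNeighbors.1 hu).2, (mem_freeNeighbors.1 hu).1.ne']
    rw [truncatedRatio_succ, ratio_eq hv (hP _).1.ne']
    set a := ∑ u ∈ freeNeighbors G S v, truncatedRatio x k G ((insert v S : Finset V) : Set V) u
      with ha
    set b := ∑ u ∈ freeNeighbors G S v, (avoidingPoly G (insert u (insert v S))).eval x /
        (avoidingPoly G (insert v S)).eval x with hb
    have ha1 : a ≤ (freeNeighbors G S v).card • (1 : ℝ) :=
      Finset.sum_le_card_nsmul _ _ _ fun u _ => (truncatedRatio_mem hG hx' k _ u).2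
    have hb1 : b ≤ (freeNeighbors G S v).card • (1 : ℝ) :=
      Finset.sum_le_card_nsmul _ _ _ fun u hu =>
        div_le_one_of_le₀ ((hP _).2 u (hu' u hu)) (hP _).1.le
    have hab : |a - b| ≤ (freeNeighbors G S v).card • ((1 / 2 : ℝ) ^ k) := by
      rw [ha, hb, ← Finset.sum_sub_distrib]
      exact (Finset.abs_sum_le_sum_abs _ _).trans
        (Finset.sum_le_card_nsmul _ _ _ fun u hu => ih _ u (hu' u hu))
    rw [nsmul_eq_mul] at ha1 hb1 hab
    have hxa : (d : ℝ) + 2 ≤ x - a := by linarith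
    have hxb : (d : ℝ) + 2 ≤ x - b := by linarith
    have hpos : 0 < (x - a) * (x - b) := mul_pos (by linarith) (by linarith)
    rw [inv_sub_inv (by linarith) (by linarith), abs_div, abs_of_pos hpos, div_le_iff₀ hpos,
      sub_sub_sub_cancel_left]
    have hk : 0 < (1 / 2 : ℝ) ^ k := by positivity
    have h3 : |a - b| ≤ d * (1 / 2 : ℝ) ^ k :=
      hab.trans (mul_le_mul_of_nonneg_right h2 hk.le)
    have h4 : 2 * (d : ℝ) ≤ (x - a) * (x - b) := by nlinarith
    calc |a - b| ≤ d * (1 / 2 : ℝ) ^ k := h3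
      _ = (1 / 2 : ℝ) ^ (k + 1) * (2 * d) := by ring
      _ ≤ _ := mul_le_mul_of_nonneg_left h4 (by positivity)

end Ratio

/-! ### Averages of local functions, and convergence of resolvents. -/

section Average

theorem card_ballSet_le {V : Type u} [Finite V] {G : SimpleGraph V} {d : ℕ}
    (hG : ∀ v, (G.neighborSet v).encard ≤ d) (r : ℕ) (v : V) :
    (ballSet G v r).encard ≤ ((d + 1) ^ r : ℕ) := by
  induction r generalizing v with
  | zero =>
    have : ballSet G v 0 = {v} := by
      ext w
      rw [ballSet, Set.mem_ofPred_eq, Nat.cast_zero, nonpos_iff_eq_zero,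
        SimpleGraph.edist_eq_zero_iff, Set.mem_singleton_iff, eq_comm]
    simp [this]
  | succ r ih =>
    have hsub : ballSet G v (r + 1) ⊆ {v} ∪ ⋃ u ∈ (G.neighborSet v).toFinite.toFinset,
        ballSet G u r := by
      intro w hw
      have hne : G.edist v w ≠ ⊤ := ne_top_of_le_ne_top (ENat.natCast_ne_top (r + 1)) hw
      obtain ⟨p, hp⟩ := SimpleGraph.exists_walk_of_edist_ne_top hne
      cases p with
      | nil => simp
      | @cons _ u _ hvu q =>
        right
        simp only [Set.Finite.mem_toFinset, Set.mem_iUnion]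
        refine ⟨u, hvu, (SimpleGraph.Walk.edist_le q).trans ?_⟩
        have hw' : G.edist v w ≤ (r + 1 : ℕ) := hw
        rw [← hp, SimpleGraph.Walk.length_cons] at hw'
        exact_mod_cast Nat.le_of_succ_le_succ (by exact_mod_cast hw')
    have h2 : ((G.neighborSet v).toFinite.toFinset.card : ℕ∞) ≤ d := by
      rw [← Set.encard_coe_eq_coe_finsetCard, Set.Finite.coe_toFinset]
      exact hG v
    have h3 : (G.neighborSet v).toFinite.toFinset.card ≤ d := by exact_mod_cast h2
    calc (ballSet G v (r + 1)).encard
        ≤ 1 + ∑ u ∈ (G.neighborSet v).toFinite.toFinset, (ballSet G u r).encard := by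
          refine (Set.encard_le_encard hsub).trans ((Set.encard_union_le _ _).trans ?_)
          rw [Set.encard_singleton]
          gcongr
          exact Finset.set_encard_biUnion_le _ _
      _ ≤ 1 + ∑ u ∈ (G.neighborSet v).toFinite.toFinset, (((d + 1) ^ r : ℕ) : ℕ∞) := by
          gcongr with u
          exact ih u
      _ ≤ ((d + 1) ^ (r + 1) : ℕ) := by
          rw [Finset.sum_const, nsmul_eq_mul]
          norm_cast
          calc 1 + _ * (d + 1) ^ r ≤ (d + 1) ^ r + d * (d + 1) ^ r :=
                add_le_add (Nat.one_le_pow _ _ (by omega)) (Nat.mul_le_mul_right _ h3)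
            _ = (d + 1) ^ (r + 1) := by ring

/-- Representatives for all rooted graphs with at most `N` vertices. -/
abbrev RootedGraph (N : ℕ) : Type := Σ m : Fin (N + 1), SimpleGraph (Fin m) × Fin m

theorem BallIso.trans_iff {V : Type u} {W W' : Type*} {G : SimpleGraph V} {v : V} {r : ℕ}
    {α : SimpleGraph W} {o : W} {β : SimpleGraph W'} {p : W'} (h : BallIso G v r α o) :
    BallIso G v r β p ↔ ∃ φ : α ≃g β, φ o = p := by
  obtain ⟨φ, hφ⟩ := h
  constructor
  · rintro ⟨ψ, hψ⟩
    exact ⟨φ.symm.trans ψ, by rw [← hφ]; simpa using hψ⟩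
  · rintro ⟨ψ, hψ⟩
    exact ⟨φ.trans ψ, by simpa [hφ] using hψ⟩

theorem exists_ballIso {V : Type u} [Finite V] {G : SimpleGraph V} {d : ℕ}
    (hG : ∀ v, (G.neighborSet v).encard ≤ d) (r : ℕ) (v : V) :
    ∃ i : RootedGraph ((d + 1) ^ r), BallIso G v r i.2.1 i.2.2 := by
  have hcard : Nat.card (ballSet G v r) ≤ (d + 1) ^ r := by
    have := card_ballSet_le hG r v
    rw [← Set.Finite.cast_ncard_eq (Set.toFinite _)] at this
    exact_mod_cast this
  let e : ballSet G v r ≃ Fin (Nat.card (ballSet G v r)) := Finite.equivFin _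
  refine ⟨⟨⟨_, Nat.lt_succ_of_le hcard⟩, (G.induce (ballSet G v r)).comap e.symm,
    e (ballCenter G v r)⟩, (SimpleGraph.Iso.comap e.symm _).symm, rfl⟩

/-- Bounded degree leaves finitely many isomorphism types of r-balls, so the average is a fixed
finite linear combination of ball probabilities. -/
theorem exists_tendsto_average {V : ℕ → Type u} [∀ n, Fintype (V n)]
    {G : ∀ n, SimpleGraph (V n)} {d : ℕ} (hG : DegreeBound G d) (h : BSConvergent G) {r : ℕ}
    (hr : 0 < r) (f : ∀ n, V n → ℝ) (g : ∀ m, SimpleGraph (Fin m) → Fin m → ℝ)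
    (hfg : ∀ n v m α o, BallIso (G n) v r α o → f n v = g m α o) :
    ∃ l, Tendsto (fun n => (∑ v, f n v) / Fintype.card (V n)) atTop (𝓝 l) := by
  classical
  -- The list of representatives repeats each isomorphism class; `c i` is the number of repetitions,
  -- by which the weights are divided to avoid overcounting.
  let c : RootedGraph ((d + 1) ^ r) → ℕ := fun i =>
    (Finset.univ.filter fun j : RootedGraph ((d + 1) ^ r) =>
      ∃ φ : i.2.1 ≃g j.2.1, φ i.2.2 = j.2.2).card
  have hc : ∀ n v i, BallIso (G n) v r i.2.1 i.2.2 →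
      (Finset.univ.filter fun j : RootedGraph ((d + 1) ^ r) =>
        BallIso (G n) v r j.2.1 j.2.2).card = c i := fun n v i hi =>
    congrArg Finset.card (Finset.filter_congr fun j _ => hi.trans_iff)
  have hf : ∀ n v, f n v = ∑ i : RootedGraph ((d + 1) ^ r),
      if BallIso (G n) v r i.2.1 i.2.2 then g _ i.2.1 i.2.2 / c i else 0 := by
    intro n v
    obtain ⟨i₀, h₀⟩ := exists_ballIso (hG n) r v
    rw [← Finset.sum_filter, Finset.sum_congr rfl (g := fun _ => f n v / c i₀), Finset.sum_const,
      hc n v i₀ h₀, nsmul_eq_mul, mul_div_cancel₀]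
    · have : 0 < c i₀ := by
        rw [← hc n v i₀ h₀]
        exact Finset.card_pos.2 ⟨i₀, by simpa using h₀⟩
      exact_mod_cast this.ne'
    · intro i hi
      have hi' := (Finset.mem_filter.1 hi).2
      rw [hfg n v _ _ _ hi', ← hc n v i hi', hc n v i₀ h₀]
  have hsum : ∀ n, (∑ v, f n v) / Fintype.card (V n) = ∑ i : RootedGraph ((d + 1) ^ r),
      ballProb (G n) i.2.1 i.2.2 r * (g _ i.2.1 i.2.2 / c i) := by
    intro n
    simp_rw [hf n]
    rw [Finset.sum_comm, Finset.sum_div]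
    refine Finset.sum_congr rfl fun i _ => ?_
    rw [← Finset.sum_filter, Finset.sum_const, nsmul_eq_mul, ballProb, Nat.card_eq_fintype_card,
      Nat.card_eq_fintype_card, Fintype.card_subtype]
    ring
  simp_rw [hsum]
  choose p hp using fun i : RootedGraph ((d + 1) ^ r) => h _ i.2.1 i.2.2 r hr
  exact ⟨_, tendsto_finsetSum _ fun i _ => (hp i).mul_const _⟩

theorem card_freeNeighbors_le {V : Type u} [Fintype V] [DecidableEq V] {G : SimpleGraph V} {d : ℕ}
    (hG : ∀ v, (G.neighborSet v).encard ≤ d) (v : V) : (freeNeighbors G ∅ v).card ≤ d := by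
  have := hG v
  rw [show G.neighborSet v = (freeNeighbors G ∅ v : Set V) by
    ext u; simp [mem_freeNeighbors], Set.encard_coe_eq_coe_finsetCard] at this
  exact_mod_cast this

/-- The sum of 1/(x-r) is the logarithmic derivative of the matching polynomial, hence a sum over
vertices of ratios, each uniformly approximated by a local function. -/
theorem exists_tendsto_resolvent {V : ℕ → Type u} [∀ n, Fintype (V n)] [∀ n, DecidableEq (V n)]
    [∀ n, Nonempty (V n)] {G : ∀ n, SimpleGraph (V n)} {d : ℕ} (hd : 2 ≤ d) (hG : DegreeBound G d)
    (h : BSConvergent G) {x : ℝ} (hx : 2 * d + 2 ≤ x) :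
    ∃ l, Tendsto (fun n => ((matchingRoots (G n)).map fun r => 1 / (x - r)).sum /
      Fintype.card (V n)) atTop (𝓝 l) := by
  have hd' : (2 : ℝ) ≤ d := by exact_mod_cast hd
  have hG' : ∀ n v, (freeNeighbors (G n) ∅ v).card ≤ d := fun n =>
    card_freeNeighbors_le (hG n)
  have hsum : ∀ n, ((matchingRoots (G n)).map fun r => 1 / (x - r)).sum =
      ∑ v, (avoidingPoly (G n) {v}).eval x / (avoidingPoly (G n) ∅).eval x := by
    intro n
    have h0 := (avoidingPoly_insert_le hd (hG' n) (x := x) (by linarith) ∅).1.ne'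
    rw [← matchingPoly_eq] at h0
    rw [matchingRoots, ← (matchingPoly_splits (G n)).eval_derivative_div_eval_of_ne_zero h0,
      matchingPoly_eq, derivative_avoidingPoly, eval_finsetSum, Finset.sum_div]
  refine exists_tendsto_of_approx fun ε hε => ?_
  obtain ⟨k, hk⟩ := exists_pow_lt_of_lt_one hε (by norm_num : (1 / 2 : ℝ) < 1)
  -- Depth `k + 1` instead of `k`, since ball statistics are assumed to converge only for positive
  -- radius.
  refine ⟨fun n => (∑ v, truncatedRatio x (k + 1) (G n) ∅ v) / Fintype.card (V n),
    fun n => ?_, ?_⟩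
  · have hn : (0 : ℝ) < Fintype.card (V n) := by exact_mod_cast Fintype.card_pos
    rw [hsum, ← sub_div, ← Finset.sum_sub_distrib, abs_div, abs_of_pos hn, div_le_iff₀ hn]
    refine (Finset.abs_sum_le_sum_abs _ _).trans
      ((Finset.sum_le_card_nsmul _ _ ε fun v _ => ?_).trans
      (by rw [nsmul_eq_mul, mul_comm, Finset.card_univ]))
    rw [abs_sub_comm]
    have := abs_truncatedRatio_sub_le hd (hG' n) hx (k + 1) ∅ v (by simp)
    simp only [Finset.coe_empty, insert_empty_eq] at this
    refine this.trans (le_trans ?_ hk.le)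
    exact pow_le_pow_of_le_one (by norm_num) (by norm_num) (Nat.le_succ k)
  · exact exists_tendsto_average hG h (Nat.succ_pos k) _
      (fun m α o => truncatedRatio x (k + 1) α ∅ o) fun n v m α o hiso => hiso.truncatedRatio_eq

end Average

/-! ### From resolvents to moments to weak convergence on a compact interval. -/

section WeakConvergence

variable {a b : ℝ}

theorem integrable_of_continuousOn_Icc {μ : Measure ℝ} [IsFiniteMeasure μ]
    (hμ : μ (Set.Icc a b)ᶜ = 0) {f : ℝ → ℝ} (hf : ContinuousOn f (Set.Icc a b)) :
    Integrable f μ := by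
  rw [← Measure.restrict_eq_self_of_ae_mem (s := Set.Icc a b) (μ := μ) hμ]
  exact hf.integrableOn_Icc

theorem abs_integral_sub_le {μ : Measure ℝ} [IsProbabilityMeasure μ]
    (hμ : μ (Set.Icc a b)ᶜ = 0) {f g : ℝ → ℝ} (hf : ContinuousOn f (Set.Icc a b))
    (hg : ContinuousOn g (Set.Icc a b)) {C : ℝ} (h : ∀ x ∈ Set.Icc a b, |f x - g x| ≤ C) :
    |∫ x, f x ∂μ - ∫ x, g x ∂μ| ≤ C := by
  rw [← integral_sub (integrable_of_continuousOn_Icc hμ hf) (integrable_of_continuousOn_Icc hμ hg)]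
  have hae : ∀ᵐ x ∂μ, x ∈ Set.Icc a b := hμ
  simpa using norm_integral_le_of_norm_le_const (f := fun x => f x - g x) (C := C)
    (hae.mono fun x hx => h x hx)

/-- Both steps rest on x·r^j/(x-r) - r^j = r^(j+1)/(x-r). The right side tends to 0 uniformly on the
interval as x grows, so convergence of ∫ r^j/(x-r) for all large x gives the j-th moment; the
identity then gives convergence of ∫ r^(j+1)/(x-r), and the induction continues. -/
theorem exists_tendsto_integral_pow {μ : ℕ → Measure ℝ} [∀ n, IsProbabilityMeasure (μ n)]
    (hμ : ∀ n, μ n (Set.Icc a b)ᶜ = 0) {x₀ : ℝ} (hx₀ : b < x₀)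
    (h : ∀ x ≥ x₀, ∃ l, Tendsto (fun n => ∫ r, 1 / (x - r) ∂(μ n)) atTop (𝓝 l)) (j : ℕ) :
    ∃ l, Tendsto (fun n => ∫ r, r ^ j ∂(μ n)) atTop (𝓝 l) := by
  have hc : ∀ (j : ℕ), ∀ x ≥ x₀, ContinuousOn (fun r : ℝ => r ^ j / (x - r)) (Set.Icc a b) := by
    intro j x hx
    refine ContinuousOn.div (by fun_prop) (by fun_prop) fun r hr => ?_
    have := hr.2
    linarith
  have hcx : ∀ (j : ℕ), ∀ x ≥ x₀,
      ContinuousOn (fun r : ℝ => x * (r ^ j / (x - r))) (Set.Icc a b) := fun j x hx =>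
    continuousOn_const.mul (hc j x hx)
  have hp : ∀ j : ℕ, ContinuousOn (fun r : ℝ => r ^ j) (Set.Icc a b) := fun j => by fun_prop
  have key : ∀ j : ℕ, (∀ x ≥ x₀, ∃ l, Tendsto (fun n => ∫ r, r ^ j / (x - r) ∂(μ n)) atTop (𝓝 l)) →
      ∃ l, Tendsto (fun n => ∫ r, r ^ j ∂(μ n)) atTop (𝓝 l) := by
    intro j hj
    obtain ⟨C, hC⟩ := isCompact_Icc.exists_bound_of_continuousOn (hp (j + 1))
    have hC0 : 0 ≤ max C 0 := le_max_right _ _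
    refine exists_tendsto_of_approx fun ε hε => ?_
    -- Since r ≤ b < x₀, this gives x - r ≥ max C 0 / ε, so the error r^(j+1)/(x-r) is at most ε.
    set x := x₀ + max C 0 / ε with hxdef
    have hx : x ≥ x₀ := le_add_of_nonneg_right (by positivity)
    obtain ⟨l, hl⟩ := hj x hx
    refine ⟨fun n => ∫ r, x * (r ^ j / (x - r)) ∂(μ n), fun n => ?_, x * l, ?_⟩
    · refine abs_integral_sub_le (hμ n) (hp j) (hcx j x hx) fun r hr => ?_
      have hxr : 0 < x - r := by linarith [hr.2]
      have : r ^ j - x * (r ^ j / (x - r)) = -(r ^ (j + 1) / (x - r)) := by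
        field_simp
        ring
      rw [this, abs_neg, abs_div, abs_of_pos hxr, div_le_iff₀ hxr]
      calc |r ^ (j + 1)| ≤ C := hC r hr
        _ ≤ max C 0 := le_max_left _ _
        _ = ε * (max C 0 / ε) := by field_simp
        _ ≤ ε * (x - r) := by
          apply mul_le_mul_of_nonneg_left _ hε.le
          rw [hxdef]
          linarith [hr.2]
    · simp_rw [integral_const_mul]
      exact hl.const_mul x
  refine key j ?_
  induction j with
  | zero => simpa using h
  | succ j ih =>
    intro x hx
    obtain ⟨l, hl⟩ := ih x hx
    obtain ⟨m, hm⟩ := key j ih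
    refine ⟨x * l - m, ((hl.const_mul x).sub hm).congr fun n => ?_⟩
    rw [← integral_const_mul, ← integral_sub
      (integrable_of_continuousOn_Icc (hμ n) (hcx j x hx))
      (integrable_of_continuousOn_Icc (hμ n) (hp j))]
    have hae : ∀ᵐ r ∂(μ n), r ∈ Set.Icc a b := hμ n
    refine integral_congr_ae (hae.mono fun r hr => ?_)
    have hxr : x - r ≠ 0 := by linarith [hr.2]
    field_simp
    ring

theorem exists_tendsto_integral_of_moments {μ : ℕ → Measure ℝ} [∀ n, IsProbabilityMeasure (μ n)]
    (hμ : ∀ n, μ n (Set.Icc a b)ᶜ = 0)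
    (h : ∀ j : ℕ, ∃ l, Tendsto (fun n => ∫ r, r ^ j ∂(μ n)) atTop (𝓝 l)) {f : ℝ → ℝ}
    (hf : ContinuousOn f (Set.Icc a b)) :
    ∃ l, Tendsto (fun n => ∫ r, f r ∂(μ n)) atTop (𝓝 l) := by
  have hpoly : ∀ p : ℝ[X], ∃ l, Tendsto (fun n => ∫ r, p.eval r ∂(μ n)) atTop (𝓝 l) := by
    intro p
    induction p using Polynomial.induction_on' with
    | add p q hp hq =>
      obtain ⟨l, hl⟩ := hp
      obtain ⟨m, hm⟩ := hq
      refine ⟨l + m, (hl.add hm).congr fun n => ?_⟩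
      simp_rw [eval_add]
      rw [integral_add (integrable_of_continuousOn_Icc (hμ n) p.continuous.continuousOn)
        (integrable_of_continuousOn_Icc (hμ n) q.continuous.continuousOn)]
    | monomial j c =>
      obtain ⟨l, hl⟩ := h j
      refine ⟨c * l, (hl.const_mul c).congr fun n => ?_⟩
      simp_rw [eval_monomial]
      rw [integral_const_mul]
  refine exists_tendsto_of_approx fun ε hε => ?_
  obtain ⟨p, hp⟩ := exists_polynomial_near_of_continuousOn a b f hf ε hε
  refine ⟨_, fun n => ?_, hpoly p⟩
  refine abs_integral_sub_le (hμ n) hf p.continuous.continuousOn fun x hx => ?_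
  rw [abs_sub_comm]
  exact (hp x hx).le

/-- Probability measures on a fixed compact interval form a compact set, which gives a limit ρ along
a nonprincipal ultrafilter. Since all integrals converge along the whole sequence, their limits must
be the integrals against ρ. -/
theorem exists_tendsto_probabilityMeasure {μ : ℕ → ProbabilityMeasure ℝ}
    (hμ : ∀ n, (μ n : Measure ℝ) (Set.Icc a b)ᶜ = 0)
    (h : ∀ f : ℝ → ℝ, Continuous f →
      ∃ l, Tendsto (fun n => ∫ r, f r ∂(μ n : Measure ℝ)) atTop (𝓝 l)) :
    ∃ ρ : ProbabilityMeasure ℝ, (ρ : Measure ℝ) (Set.Icc a b)ᶜ = 0 ∧ Tendsto μ atTop (𝓝 ρ) := by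
  -- With allowed outside mass constantly 0 and one fixed compact set, the tight family consists of
  -- the measures carried by `Icc a b`.
  have hK := isCompact_setOfPred_probabilityMeasure_mass_eq_compl_isCompact_le
    (u := fun _ => 0) (K := fun _ => Set.Icc a b) tendsto_const_nhds (fun _ => isCompact_Icc)
    (Or.inl inferInstance)
  let U := hyperfilter ℕ
  have hU : (U : Filter ℕ) ≤ atTop := by
    rw [← Nat.cofinite_eq_atTop]
    exact hyperfilter_le_cofinite
  obtain ⟨ρ, hρ, hUρ⟩ := hK.ultrafilter_le_nhds (U.map μ) (by
    rw [le_principal_iff]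
    refine Ultrafilter.mem_map.2 (Filter.mem_of_superset Filter.univ_mem fun n _ => ?_)
    intro k
    have := hμ n
    rw [← ProbabilityMeasure.ennreal_coeFn_eq_coeFn_toMeasure] at this
    exact_mod_cast this.le)
  have hρ' : (ρ : Measure ℝ) (Set.Icc a b)ᶜ = 0 := by
    have := hρ 0
    rw [← ProbabilityMeasure.ennreal_coeFn_eq_coeFn_toMeasure]
    exact_mod_cast nonpos_iff_eq_zero.1 this
  refine ⟨ρ, hρ', ProbabilityMeasure.tendsto_iff_forall_integral_tendsto.2 fun f => ?_⟩
  obtain ⟨l, hl⟩ := h f f.continuous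
  have h1 := ProbabilityMeasure.tendsto_iff_forall_integral_tendsto.1
    (show Tendsto μ U (𝓝 ρ) from hUρ) f
  rwa [tendsto_nhds_unique h1 (hl.mono_left hU)]

/-- Precomposing f with the projection onto the interval makes it bounded and continuous on ℝ
without changing any of the integrals. -/
theorem tendsto_integral_of_continuous {μ : ℕ → ProbabilityMeasure ℝ} {ρ : ProbabilityMeasure ℝ}
    (hab : a ≤ b) (hμ : ∀ n, (μ n : Measure ℝ) (Set.Icc a b)ᶜ = 0)
    (hρ : (ρ : Measure ℝ) (Set.Icc a b)ᶜ = 0) (h : Tendsto μ atTop (𝓝 ρ)) {f : ℝ → ℝ}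
    (hf : ContinuousOn f (Set.Icc a b)) :
    Tendsto (fun n => ∫ r, f r ∂(μ n : Measure ℝ)) atTop (𝓝 (∫ r, f r ∂(ρ : Measure ℝ))) := by
  let F : C(Set.Icc a b, ℝ) := ⟨_, hf.domRestrict⟩
  let g : BoundedContinuousFunction ℝ ℝ :=
    (BoundedContinuousFunction.mkOfCompact F).compContinuous ⟨_, continuous_projIcc (h := hab)⟩
  have hg : ∀ ν : ProbabilityMeasure ℝ, (ν : Measure ℝ) (Set.Icc a b)ᶜ = 0 →
      ∫ r, g r ∂(ν : Measure ℝ) = ∫ r, f r ∂(ν : Measure ℝ) := by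
    intro ν hν
    have hae : ∀ᵐ r ∂(ν : Measure ℝ), r ∈ Set.Icc a b := hν
    refine integral_congr_ae (hae.mono fun r hr => ?_)
    change f (Set.projIcc a b hab r) = f r
    rw [Set.projIcc_of_mem hab hr]
  rw [← hg ρ hρ]
  exact (ProbabilityMeasure.tendsto_iff_forall_integral_tendsto.1 h g).congr fun n => hg _ (hμ n)

end WeakConvergence

/-! ### The matching measure as a measure on the real line. -/

section RootMeasure

/-- The uniform distribution on a finite multiset of real numbers. -/
noncomputable def uniformMeasure (R : Multiset ℝ) : Measure ℝ :=
  (R.card : ℝ≥0∞)⁻¹ • ∑ z ∈ R.toFinset, (R.count z : ℝ≥0∞) • Measure.dirac z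

theorem isProbabilityMeasure_uniformMeasure {R : Multiset ℝ} (hR : R.card ≠ 0) :
    IsProbabilityMeasure (uniformMeasure R) := by
  constructor
  rw [uniformMeasure, Measure.smul_apply, Measure.finsetSum_apply]
  simp only [Measure.smul_apply, measure_univ, smul_eq_mul, mul_one]
  rw [← Nat.cast_sum, Multiset.toFinset_sum_count_eq]
  exact ENNReal.inv_mul_cancel (by exact_mod_cast hR) (ENNReal.natCast_ne_top _)

theorem uniformMeasure_eq_zero {R : Multiset ℝ} {A : Set ℝ} (hA : MeasurableSet A)
    (h : ∀ r ∈ R, r ∉ A) : uniformMeasure R A = 0 := by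
  rw [uniformMeasure, Measure.smul_apply, Measure.finsetSum_apply, Finset.sum_eq_zero, smul_zero]
  intro r hr
  rw [Measure.smul_apply, Measure.dirac_apply' _ hA,
    Set.indicator_of_notMem (h r (Multiset.mem_toFinset.1 hr)), smul_zero]

theorem integral_uniformMeasure (R : Multiset ℝ) (f : ℝ → ℝ) :
    ∫ x, f x ∂(uniformMeasure R) = (R.map f).sum / R.card := by
  rw [uniformMeasure, integral_smul_measure, integral_finsetSum_measure,
    Finset.sum_multiset_map_count, smul_eq_mul, ENNReal.toReal_inv, ENNReal.toReal_natCast,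
    div_eq_inv_mul]
  · simp [integral_smul_measure]
  · intro z _
    exact (integrable_dirac (by simp)).smul_measure (ENNReal.natCast_ne_top _)

theorem matchingMeasure_eq {V : Type u} [Fintype V] [DecidableEq V] (G : SimpleGraph V) :
    matchingMeasure G = (uniformMeasure (matchingRoots G)).map Complex.ofReal := by
  rw [matchingMeasure, uniformMeasure, aroots_matchingPoly, card_matchingRoots,
    Nat.card_eq_fintype_card, Measure.map_smul]
  congr 1
  rw [← Measure.mapₗ_apply_of_measurable Complex.measurable_ofReal, map_sum,
    Multiset.toFinset_map, Finset.sum_image Complex.ofReal_injective.injOn]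
  refine Finset.sum_congr rfl fun r _ => ?_
  rw [map_smul, Measure.mapₗ_apply_of_measurable Complex.measurable_ofReal,
    Measure.map_dirac' Complex.measurable_ofReal,
    Multiset.count_map_eq_count' _ _ Complex.ofReal_injective]

end RootMeasure

/-! ### Matching statistics as sums and products over roots. -/

section Identities

variable {V : Type u} [Fintype V] (G : SimpleGraph V)

/-- The matching generating polynomial `∑_k m_k X^(v - 2k)`. -/
noncomputable def defectPoly : ℝ[X] :=
  ∑ F ∈ matchingsAvoiding G ∅, X ^ (Fintype.card V - 2 * F.card)

theorem eval_defectPoly_pos {y : ℝ} (hy : 0 < y) : 0 < (defectPoly G).eval y := by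
  rw [defectPoly, eval_finsetSum]
  refine Finset.sum_pos (fun F _ => by simpa using pow_pos hy _)
    ⟨∅, mem_matchingsAvoiding.2 ⟨by simp, by simp, by simp⟩⟩

variable [DecidableEq V]

/-- The sign (-1)^k cancels against i^(-2k), leaving the common factor i^v. -/
theorem aeval_I_mul_matchingPoly (y : ℝ) : aeval (Complex.I * y) (matchingPoly G) =
    Complex.I ^ Fintype.card V * ((defectPoly G).eval y : ℝ) := by
  rw [matchingPoly_eq, avoidingPoly, map_sum, defectPoly, eval_finsetSum, Complex.ofReal_sum,
    Finset.mul_sum]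
  refine Finset.sum_congr rfl fun F hF => ?_
  have := (mem_matchingsAvoiding.1 hF).two_mul_card_le
  rw [Finset.compl_empty, Finset.card_univ] at this ⊢
  obtain ⟨k, hk⟩ := Nat.exists_eq_add_of_le this
  rw [hk, Nat.add_sub_cancel_left, pow_add, pow_mul, Complex.I_sq]
  simp [mul_pow]
  ring

theorem eval_defectPoly_sq (y : ℝ) : (defectPoly G).eval y ^ 2 =
    ((matchingRoots G).map fun r => y ^ 2 + r ^ 2).prod := by
  have h := congrArg Complex.normSq (aeval_I_mul_matchingPoly G y)
  rw [aeval_matchingPoly, map_mul, map_pow, Complex.normSq_I, one_pow, one_mul,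
    Complex.normSq_ofReal, ← sq, map_multiset_prod, Multiset.map_map] at h
  rw [← h]
  congr 1
  refine Multiset.map_congr rfl fun r _ => ?_
  simp [Complex.normSq_apply]
  ring

theorem log_eval_defectPoly {y : ℝ} (hy : 0 < y) : Real.log ((defectPoly G).eval y) =
    1 / 2 * ((matchingRoots G).map fun r => Real.log (y ^ 2 + r ^ 2)).sum := by
  have h := congrArg Real.log (eval_defectPoly_sq G y)
  have hprod : ∀ R : Multiset ℝ, Real.log (R.map fun r => y ^ 2 + r ^ 2).prod =
      (R.map fun r => Real.log (y ^ 2 + r ^ 2)).sum ∧ 0 < (R.map fun r => y ^ 2 + r ^ 2).prod := by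
    intro R
    induction R using Multiset.induction_on with
    | empty => simp
    | cons r R ih =>
      have hr : 0 < y ^ 2 + r ^ 2 := by positivity
      simp only [Multiset.map_cons, Multiset.prod_cons, Multiset.sum_cons]
      exact ⟨by rw [Real.log_mul hr.ne' ih.2.ne', ih.1], mul_pos hr ih.2⟩
  rw [Real.log_pow, (hprod _).1] at h
  rw [← h]
  push_cast
  ring

theorem eval_one_defectPoly : (defectPoly G).eval 1 = numMatchings G := by
  simp [defectPoly, eval_finsetSum, numMatchings_eq]

theorem log_numMatchings : Real.log (numMatchings G) =
    1 / 2 * ((matchingRoots G).map fun r => Real.log (1 + r ^ 2)).sum := by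
  rw [← eval_one_defectPoly, log_eval_defectPoly G one_pos]
  simp

theorem hasDerivAt_multiset_sum (R : Multiset ℝ) {f f' : ℝ → ℝ → ℝ} {y : ℝ}
    (h : ∀ r, HasDerivAt (f r) (f' r y) y) :
    HasDerivAt (fun y => (R.map fun r => f r y).sum) (R.map fun r => f' r y).sum y := by
  induction R using Multiset.induction_on with
  | empty => simpa using hasDerivAt_const y (0 : ℝ)
  | cons r R ih =>
    simp only [Multiset.map_cons, Multiset.sum_cons]
    exact (h r).fun_add ih

theorem logDeriv_defectPoly {y : ℝ} (hy : 0 < y) :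
    (derivative (defectPoly G)).eval y / (defectPoly G).eval y =
      ((matchingRoots G).map fun r => y / (y ^ 2 + r ^ 2)).sum := by
  have h1 : HasDerivAt (fun y => Real.log ((defectPoly G).eval y))
      ((derivative (defectPoly G)).eval y / (defectPoly G).eval y) y :=
    ((defectPoly G).hasDerivAt y).log (eval_defectPoly_pos G hy).ne'
  have h2 := (hasDerivAt_multiset_sum (matchingRoots G)
    (f := fun r y => Real.log (y ^ 2 + r ^ 2)) (f' := fun r y => 2 * (y / (y ^ 2 + r ^ 2)))
    (y := y) fun r => by
      convert ((hasDerivAt_pow 2 y).add_const (r ^ 2)).log (by positivity) using 1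
      simp
      ring).const_mul (1 / 2)
  -- The logarithmic identity is known only for positive arguments, which suffices near y.
  have h3 := h2.congr_of_eventuallyEq
    (f₁ := fun y => Real.log ((defectPoly G).eval y)) (by
      filter_upwards [lt_mem_nhds hy] with z hz
      exact log_eval_defectPoly G hz)
  rw [h1.unique h3, Multiset.sum_map_mul_left]
  ring

theorem logDeriv_deriv_defectPoly :
    ((derivative (derivative (defectPoly G))).eval 1 * (defectPoly G).eval 1 -
      (derivative (defectPoly G)).eval 1 * (derivative (defectPoly G)).eval 1) /
        (defectPoly G).eval 1 ^ 2 =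
      ((matchingRoots G).map fun r => (r ^ 2 - 1) / (1 + r ^ 2) ^ 2).sum := by
  have h1 := ((derivative (defectPoly G)).hasDerivAt 1).fun_div ((defectPoly G).hasDerivAt 1)
    (eval_defectPoly_pos G one_pos).ne'
  have h2 := hasDerivAt_multiset_sum (matchingRoots G)
    (f := fun r y => y / (y ^ 2 + r ^ 2)) (f' := fun r _ => (r ^ 2 - 1) / (1 + r ^ 2) ^ 2)
    (y := 1) fun r => by
      convert! (hasDerivAt_id (1 : ℝ)).fun_div ((hasDerivAt_pow 2 (1 : ℝ)).add_const (r ^ 2))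
        (by positivity) using 1
      simp
      ring
  have h3 := h2.congr_of_eventuallyEq
    (f₁ := fun y => (derivative (defectPoly G)).eval y / (defectPoly G).eval y) (by
      filter_upwards [lt_mem_nhds one_pos] with z hz
      exact logDeriv_defectPoly G hz)
  exact h1.unique h3

theorem eval_one_derivative_defectPoly : (derivative (defectPoly G)).eval 1 =
    ∑ F ∈ matchingsAvoiding G ∅, ((Fintype.card V : ℝ) - 2 * F.card) := by
  rw [defectPoly, derivative_sum, eval_finsetSum]
  refine Finset.sum_congr rfl fun F hF => ?_
  have := (mem_matchingsAvoiding.1 hF).two_mul_card_le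
  rw [Finset.compl_empty, Finset.card_univ] at this
  simp [derivative_X_pow, Nat.cast_sub this]

theorem eval_one_derivative_derivative_defectPoly :
    (derivative (derivative (defectPoly G))).eval 1 =
      ∑ F ∈ matchingsAvoiding G ∅,
        ((Fintype.card V : ℝ) - 2 * F.card) * ((Fintype.card V : ℝ) - 2 * F.card - 1) := by
  rw [defectPoly, derivative_sum, derivative_sum, eval_finsetSum]
  refine Finset.sum_congr rfl fun F hF => ?_
  have := (mem_matchingsAvoiding.1 hF).two_mul_card_le
  rw [Finset.compl_empty, Finset.card_univ] at this
  obtain ⟨k, hk⟩ := Nat.exists_eq_add_of_le this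
  rw [hk, Nat.add_sub_cancel_left]
  cases k with
  | zero => simp
  | succ k =>
    simp [derivative_X_pow]

theorem numMatchings_pos : (0 : ℝ) < numMatchings G := by
  rw [← eval_one_defectPoly]
  exact eval_defectPoly_pos G one_pos

theorem expectedMatchingSize_eq : expectedMatchingSize G =
    (∑ F ∈ matchingsAvoiding G ∅, (F.card : ℝ)) / numMatchings G := by
  have h := sum_numMatchingsOfSize G fun _ => 1
  simp only [one_mul] at h
  rw [expectedMatchingSize, h, sum_numMatchingsOfSize G fun k => (k : ℝ)]
  simp [numMatchings_eq]

theorem varianceMatchingSize_eq : varianceMatchingSize G =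
    (∑ F ∈ matchingsAvoiding G ∅, ((F.card : ℝ) - expectedMatchingSize G) ^ 2) /
      numMatchings G := by
  have h := sum_numMatchingsOfSize G fun _ => 1
  simp only [one_mul] at h
  rw [varianceMatchingSize, h,
    sum_numMatchingsOfSize G fun k => ((k : ℝ) - expectedMatchingSize G) ^ 2]
  simp [numMatchings_eq]

theorem expectedMatchingSize_eq_sum_roots : expectedMatchingSize G =
    1 / 2 * ((matchingRoots G).map fun r => r ^ 2 / (1 + r ^ 2)).sum := by
  have hM := numMatchings_pos G
  have h1 := logDeriv_defectPoly G one_pos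
  rw [eval_one_defectPoly, eval_one_derivative_defectPoly, Finset.sum_sub_distrib,
    Finset.sum_const, ← Finset.mul_sum, ← numMatchings_eq, nsmul_eq_mul] at h1
  have h2 : ((matchingRoots G).map fun r => r ^ 2 / (1 + r ^ 2)).sum =
      (Fintype.card V : ℝ) - ((matchingRoots G).map fun r => (1 : ℝ) / (1 ^ 2 + r ^ 2)).sum := by
    have : ((matchingRoots G).map fun _ => (1 : ℝ)).sum = Fintype.card V := by
      simp [card_matchingRoots]
    rw [← this, ← Multiset.sum_map_sub]
    refine congrArg _ (Multiset.map_congr rfl fun r _ => ?_)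
    have : 1 + r ^ 2 ≠ 0 := by positivity
    field_simp
    ring
  rw [h2, ← h1, expectedMatchingSize_eq]
  field_simp
  ring

/-- Let N = v - 2γ be the number of uncovered vertices and D the generating polynomial. At 1, D'/D
is the mean of N and (D'/D)' is Var N - 𝔼N, so their sum is Var N = 4 Var γ. On the root side,
1/(1+r²) + (r²-1)/(1+r²)² = 2r²/(1+r²)². -/
theorem varianceMatchingSize_eq_sum_roots : varianceMatchingSize G =
    1 / 2 * ((matchingRoots G).map fun r => r ^ 2 / (1 + r ^ 2) ^ 2).sum := by
  have hM := numMatchings_pos G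
  have h1 := logDeriv_defectPoly G one_pos
  have h2 := logDeriv_deriv_defectPoly G
  have h3 : ((matchingRoots G).map fun r => r ^ 2 / (1 + r ^ 2) ^ 2).sum =
      1 / 2 * (((matchingRoots G).map fun r => (1 : ℝ) / (1 ^ 2 + r ^ 2)).sum +
        ((matchingRoots G).map fun r => (r ^ 2 - 1) / (1 + r ^ 2) ^ 2).sum) := by
    rw [← Multiset.sum_map_add, ← Multiset.sum_map_mul_left]
    refine congrArg _ (Multiset.map_congr rfl fun r _ => ?_)
    have : 1 + r ^ 2 ≠ 0 := by positivity
    field_simp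
    ring
  rw [h3, ← h1, ← h2, eval_one_defectPoly, varianceMatchingSize_eq, expectedMatchingSize_eq,
    eval_one_derivative_defectPoly, eval_one_derivative_derivative_defectPoly]
  have e1 : ∑ F ∈ matchingsAvoiding G ∅, ((Fintype.card V : ℝ) - 2 * F.card) =
      numMatchings G * Fintype.card V - 2 * ∑ F ∈ matchingsAvoiding G ∅, (F.card : ℝ) := by
    rw [Finset.sum_sub_distrib, Finset.sum_const, ← Finset.mul_sum, ← numMatchings_eq,
      nsmul_eq_mul]
  have e2 : ∑ F ∈ matchingsAvoiding G ∅,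
      ((Fintype.card V : ℝ) - 2 * F.card) * ((Fintype.card V : ℝ) - 2 * F.card - 1) =
      numMatchings G * (Fintype.card V * (Fintype.card V - 1)) +
        (2 - 4 * Fintype.card V) * ∑ F ∈ matchingsAvoiding G ∅, (F.card : ℝ) +
        4 * ∑ F ∈ matchingsAvoiding G ∅, (F.card : ℝ) ^ 2 := by
    rw [Finset.mul_sum, Finset.mul_sum, numMatchings_eq, ← nsmul_eq_mul, ← Finset.sum_const,
      ← Finset.sum_add_distrib, ← Finset.sum_add_distrib]
    exact Finset.sum_congr rfl fun F _ => by ring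
  have e3 : ∀ c : ℝ, ∑ F ∈ matchingsAvoiding G ∅, ((F.card : ℝ) - c) ^ 2 =
      ∑ F ∈ matchingsAvoiding G ∅, (F.card : ℝ) ^ 2 -
        2 * c * ∑ F ∈ matchingsAvoiding G ∅, (F.card : ℝ) + numMatchings G * c ^ 2 := by
    intro c
    rw [Finset.mul_sum, numMatchings_eq, ← nsmul_eq_mul, ← Finset.sum_const,
      ← Finset.sum_sub_distrib, ← Finset.sum_add_distrib]
    exact Finset.sum_congr rfl fun F _ => by ring
  rw [e1, e2, e3]
  field_simp
  ring

theorem count_zero_matchingRoots :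
    (matchingRoots G).count 0 = Fintype.card V - 2 * matchingNumber G := by
  rw [matchingRoots, count_roots, rootMultiplicity_eq_natTrailingDegree',
    (natTrailingDegree_matchingPoly G).1]

theorem prod_abs_matchingRoots :
    ((matchingRoots G).map fun r => |r|).prod = numPerfectMatchings G := by
  rw [← abs_eval_zero_matchingPoly, ← coe_aeval_eq_eval, aeval_matchingPoly]
  refine Eq.trans ?_ (map_multiset_prod (absHom : ℝ →*₀ ℝ) _).symm
  rw [Multiset.map_map]
  refine congrArg _ (Multiset.map_congr rfl fun r _ => ?_)
  change |r| = |0 - r|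
  rw [zero_sub, abs_neg]

/-- The trailing coefficient is multiplicative: a factor X - r contributes -r if r ≠ 0 and 1 if r =
0. The product is thus the absolute trailing coefficient, a positive integer. -/
theorem one_le_prod_abs_nonzero_roots :
    1 ≤ (((matchingRoots G).filter (· ≠ 0)).map fun r => |r|).prod := by
  have key : ∀ R : Multiset ℝ, |((R.map fun r => X - C r).prod).trailingCoeff| =
      ((R.filter (· ≠ 0)).map fun r => |r|).prod := by
    intro R
    induction R using Multiset.induction_on with
    | empty => simp [trailingCoeff]
    | cons r R ih =>
      rw [Multiset.map_cons, Multiset.prod_cons, trailingCoeff_mul, abs_mul, ih]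
      by_cases hr : r = 0
      · simp [hr, trailingCoeff]
      · rw [Multiset.filter_cons_of_pos (p := (· ≠ 0)) _ hr, Multiset.map_cons, Multiset.prod_cons]
        congr 1
        have : (X - C r).natTrailingDegree = 0 :=
          Nat.le_zero.1 (natTrailingDegree_le_of_ne_zero (by simpa using hr))
        rw [trailingCoeff, this]
        simp
  rw [← key, matchingRoots,
    ← (matchingPoly_splits G).eq_prod_roots_of_monic (matchingPoly_monic G)]
  exact (natTrailingDegree_matchingPoly G).2

end Identities

/-! ### The mass at 0: few small nonzero roots. -/

section Atom

/-- A continuous function equal to `1` at `0` and vanishing outside a small neighbourhood. -/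
noncomputable def tent (k : ℕ) (x : ℝ) : ℝ := max 0 (1 - (k + 2) * |x|)

theorem continuous_tent (k : ℕ) : Continuous (tent k) := by
  unfold tent
  fun_prop

theorem tent_mem (k : ℕ) (x : ℝ) : tent k x ∈ Set.Icc 0 1 :=
  ⟨le_max_left _ _, max_le zero_le_one (by have := abs_nonneg x; nlinarith)⟩

theorem tent_zero (k : ℕ) : tent k 0 = 1 := by
  simp [tent]

theorem tendsto_integral_tent (ρ : ProbabilityMeasure ℝ) :
    Tendsto (fun k => ∫ x, tent k x ∂(ρ : Measure ℝ)) atTop (𝓝 ((ρ : Measure ℝ).real {0})) := by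
  rw [← integral_indicator_one (measurableSet_singleton (0 : ℝ))]
  refine tendsto_integral_of_dominated_convergence (fun _ => 1)
    (fun k => (continuous_tent k).aestronglyMeasurable) (integrable_const _)
    (fun k => ae_of_all _ fun x => ?_) (ae_of_all _ fun x => ?_)
  · rw [Real.norm_of_nonneg (tent_mem k x).1]
    exact (tent_mem k x).2
  · by_cases hx : x = 0
    · simp [hx, tent_zero]
    · rw [Set.indicator_of_notMem (by simpa using hx)]
      have hx' : 0 < |x| := abs_pos.2 hx
      obtain ⟨N, hN⟩ := exists_nat_gt (1 / |x|)
      refine tendsto_const_nhds.congr' (eventually_atTop.2 ⟨N, fun k hk => ?_⟩)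
      have h1 : (N : ℝ) ≤ k := by exact_mod_cast hk
      rw [div_lt_iff₀ hx'] at hN
      exact (max_eq_left (by nlinarith)).symm

/-- The bound holds root by root. A nonzero root with |r| ≤ 1/(k+2) has tent weight at most 1 and
log |r| ≤ -log (k+2); a larger one has tent weight 0 and log |r| ≤ log B. If the nonzero product is
at least 1, the nonzero roots carry average tent weight at most log B / log (k+2). -/
theorem sum_tent_mul_log_le {B : ℝ} (hB : 1 ≤ B) (k : ℕ) (R : Multiset ℝ)
    (hR : ∀ r ∈ R, |r| ≤ B) :
    0 < ((R.filter (· ≠ 0)).map fun r => |r|).prod ∧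
    (R.map (tent k)).sum * Real.log (k + 2) +
      Real.log ((R.filter (· ≠ 0)).map fun r => |r|).prod ≤
      R.count 0 * Real.log (k + 2) + R.card * Real.log B := by
  induction R using Multiset.induction_on with
  | empty => simp
  | cons r R ih =>
    obtain ⟨h1, h2⟩ := ih fun r hr => hR r (Multiset.mem_cons_of_mem hr)
    have hB' : 0 ≤ Real.log B := Real.log_nonneg hB
    have hL : 0 ≤ Real.log ((k : ℝ) + 2) := Real.log_nonneg (by linarith [k.cast_nonneg (α := ℝ)])
    rw [Multiset.map_cons, Multiset.sum_cons, Multiset.card_cons, Multiset.count_cons]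
    push_cast
    by_cases hr : r = 0
    · rw [hr, Multiset.filter_cons_of_neg (p := (· ≠ 0)) _ (by simp), tent_zero]
      refine ⟨h1, ?_⟩
      simp only [if_true]
      linarith
    · rw [Multiset.filter_cons_of_pos (p := (· ≠ 0)) _ hr, Multiset.map_cons, Multiset.prod_cons,
        if_neg (Ne.symm hr)]
      have hr' : 0 < |r| := abs_pos.2 hr
      refine ⟨mul_pos hr' h1, ?_⟩
      rw [Real.log_mul hr'.ne' h1.ne', add_zero]
      have h3 : Real.log |r| ≤ Real.log B := Real.log_le_log hr' (hR r (Multiset.mem_cons_self r R))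
      have h4 : tent k r * Real.log (k + 2) + Real.log |r| ≤ Real.log B := by
        rcases le_total 1 (((k : ℝ) + 2) * |r|) with h | h
        · rw [tent, max_eq_left (by linarith)]
          linarith
        · have h5 := Real.log_nonpos (by positivity) h
          rw [Real.log_mul (by positivity) hr'.ne'] at h5
          have h6 := mul_le_mul_of_nonneg_right (tent_mem k r).2 hL
          linarith
      linarith

theorem count_zero_le_sum_tent (k : ℕ) (R : Multiset ℝ) :
    (R.count 0 : ℝ) ≤ (R.map (tent k)).sum := by
  induction R using Multiset.induction_on with
  | empty => simp
  | cons r R ih =>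
    rw [Multiset.map_cons, Multiset.sum_cons, Multiset.count_cons]
    have := (tent_mem k r).1
    by_cases hr : r = 0
    · rw [hr, tent_zero]
      simp only [if_true]
      push_cast
      linarith
    · rw [if_neg (Ne.symm hr), add_zero]
      linarith

/-- The tent averages approximate the fraction of zero roots uniformly in n, which permits
exchanging the limits in n and k. -/
theorem tendsto_count_zero {R : ℕ → Multiset ℝ} (hR : ∀ n, (R n).card ≠ 0) {B : ℝ} (hB : 1 ≤ B)
    (hRB : ∀ n, ∀ r ∈ R n, |r| ≤ B)
    (hprod : ∀ n, 1 ≤ (((R n).filter (· ≠ 0)).map fun r => |r|).prod) {ρ : ProbabilityMeasure ℝ}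
    (h : ∀ k, Tendsto (fun n => ((R n).map (tent k)).sum / (R n).card) atTop
      (𝓝 (∫ x, tent k x ∂(ρ : Measure ℝ)))) :
    Tendsto (fun n => ((R n).count 0 : ℝ) / (R n).card) atTop (𝓝 ((ρ : Measure ℝ).real {0})) := by
  have hlog : ∀ k : ℕ, 0 < Real.log ((k : ℝ) + 2) := fun k =>
    Real.log_pos (by linarith [k.cast_nonneg (α := ℝ)])
  have hbound : ∀ n k, |((R n).count 0 : ℝ) / (R n).card - ((R n).map (tent k)).sum / (R n).card| ≤
      Real.log B / Real.log (k + 2) := by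
    intro n k
    have hc : (0 : ℝ) < (R n).card := by exact_mod_cast Nat.pos_of_ne_zero (hR n)
    have h1 := (sum_tent_mul_log_le hB k (R n) (hRB n)).2
    have h2 := Real.log_nonneg (hprod n)
    have h3 := count_zero_le_sum_tent k (R n)
    rw [← sub_div, abs_div, abs_of_pos hc, abs_sub_comm, abs_of_nonneg (by linarith),
      div_le_div_iff₀ hc (hlog k)]
    linarith
  have hlim : Tendsto (fun k : ℕ => Real.log B / Real.log ((k : ℝ) + 2)) atTop (𝓝 0) :=
    Tendsto.div_atTop tendsto_const_nhds (Real.tendsto_log_atTop.comp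
      (tendsto_atTop_add_const_right _ _ tendsto_natCast_atTop_atTop))
  obtain ⟨l, hl⟩ : ∃ l, Tendsto (fun n => ((R n).count 0 : ℝ) / (R n).card) atTop (𝓝 l) := by
    refine exists_tendsto_of_approx fun ε hε => ?_
    obtain ⟨k, hk⟩ := (hlim.eventually (gt_mem_nhds hε)).exists
    exact ⟨_, fun n => (hbound n k).trans hk.le, _, h k⟩
  have hl' : Tendsto (fun k => ∫ x, tent k x ∂(ρ : Measure ℝ)) atTop (𝓝 l) := by
    refine tendsto_iff_dist_tendsto_zero.2 (squeeze_zero (fun _ => dist_nonneg) (fun k => ?_) hlim)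
    rw [dist_comm, Real.dist_eq]
    exact le_of_tendsto ((hl.sub (h k)).abs) (Eventually.of_forall fun n => hbound n k)
  rwa [tendsto_nhds_unique (tendsto_integral_tent ρ) hl']

end Atom

/-! ### The extended-real integral of log |x| as a limit of truncations. -/

section LogIntegral

/-- The function `log |x|`, truncated from below at `-L`. -/
noncomputable def truncLog (L : ℕ) (x : ℝ) : ℝ := Real.log (max |x| (Real.exp (-L)))

theorem continuous_truncLog (L : ℕ) : Continuous (truncLog L) := by
  refine Continuous.log (by fun_prop) fun x => ?_
  exact (lt_max_of_lt_right (Real.exp_pos _)).ne'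

theorem truncLog_zero (L : ℕ) : truncLog L 0 = -L := by
  rw [truncLog, abs_zero, max_eq_right (Real.exp_pos _).le, Real.log_exp]

theorem truncLog_eq_max (L : ℕ) {x : ℝ} (hx : x ≠ 0) : truncLog L x = max (Real.log |x|) (-L) := by
  have hx' : 0 < |x| := abs_pos.2 hx
  rw [truncLog]
  rcases le_total |x| (Real.exp (-L)) with h | h
  · rw [max_eq_right h, Real.log_exp, max_eq_right]
    rwa [Real.log_le_iff_le_exp hx']
  · rw [max_eq_left h, max_eq_left]
    rwa [Real.le_log_iff_exp_le hx']

theorem log_ofReal_abs {x : ℝ} (hx : x ≠ 0) :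
    ENNReal.log (ENNReal.ofReal |x|) = (Real.log |x| : ℝ) := by
  rw [ENNReal.log_ofReal, if_neg (by simpa using hx)]

theorem toENNReal_log_abs (L : ℕ) (x : ℝ) :
    (ENNReal.log (ENNReal.ofReal |x|)).toENNReal = ENNReal.ofReal (truncLog L x) := by
  by_cases hx : x = 0
  · simp [hx, truncLog_zero]
  · rw [log_ofReal_abs hx, truncLog_eq_max L hx, EReal.toENNReal_of_ne_top (by simp),
      EReal.toReal_coe]
    rcases le_total (Real.log |x|) (-L) with h | h
    · have : -(L : ℝ) ≤ 0 := by simp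
      rw [max_eq_right h, ENNReal.ofReal_of_nonpos this, ENNReal.ofReal_of_nonpos (h.trans this)]
    · rw [max_eq_left h]

theorem tendsto_lintegral_neg_truncLog (μ : Measure ℝ) :
    Tendsto (fun L : ℕ => ∫⁻ x, ENNReal.ofReal (-truncLog L x) ∂μ) atTop
      (𝓝 (∫⁻ x, (-ENNReal.log (ENNReal.ofReal |x|)).toENNReal ∂μ)) := by
  refine lintegral_tendsto_of_tendsto_of_monotone
    (fun L => ((continuous_truncLog L).measurable.neg.ennreal_ofReal).aemeasurable)
    (ae_of_all _ fun x L L' hL => ?_) (ae_of_all _ fun x => ?_)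
  · have hL' : (L : ℝ) ≤ L' := by exact_mod_cast hL
    refine ENNReal.ofReal_le_ofReal (neg_le_neg (Real.log_le_log ?_ ?_))
    · exact lt_max_of_lt_right (Real.exp_pos _)
    · gcongr
  · by_cases hx : x = 0
    · simp only [hx, truncLog_zero, neg_neg, abs_zero, ENNReal.ofReal_zero, ENNReal.log_zero,
        EReal.neg_bot, EReal.toENNReal_top, ENNReal.ofReal_natCast]
      exact ENNReal.tendsto_nat_nhds_top
    · rw [log_ofReal_abs hx, ← EReal.coe_neg, EReal.toENNReal_of_ne_top (by simp), EReal.toReal_coe]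
      obtain ⟨N, hN⟩ := exists_nat_gt (-Real.log |x|)
      refine tendsto_const_nhds.congr' (eventually_atTop.2 ⟨N, fun L hL => ?_⟩)
      have : (N : ℝ) ≤ L := by exact_mod_cast hL
      change _ = ENNReal.ofReal (-truncLog L x)
      rw [truncLog_eq_max L hx, max_eq_left (by linarith)]

/-- Truncation below at -L ≤ 0 leaves the positive part unchanged, and its integral is finite. Only
the negative part varies, increasing with L to a possibly infinite limit. -/
theorem tendsto_integral_truncLog {a b : ℝ} {μ : Measure ℝ} [IsProbabilityMeasure μ]
    (hμ : μ (Set.Icc a b)ᶜ = 0) :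
    Tendsto (fun L : ℕ => ((∫ x, truncLog L x ∂μ : ℝ) : EReal)) atTop
      (𝓝 (erealIntegral μ fun x => ENNReal.log (ENNReal.ofReal |x|))) := by
  have hint : ∀ L, Integrable (truncLog L) μ := fun L =>
    integrable_of_continuousOn_Icc hμ (continuous_truncLog L).continuousOn
  have hA : ∫⁻ x, (ENNReal.log (ENNReal.ofReal |x|)).toENNReal ∂μ ≠ ⊤ := by
    simp_rw [toENNReal_log_abs 0]
    exact (hint 0).lintegral_lt_top.ne
  have heq : ∀ L, ((∫ x, truncLog L x ∂μ : ℝ) : EReal) =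
      ((∫⁻ x, (ENNReal.log (ENNReal.ofReal |x|)).toENNReal ∂μ : ℝ≥0∞) : EReal) -
        ((∫⁻ x, ENNReal.ofReal (-truncLog L x) ∂μ : ℝ≥0∞) : EReal) := by
    intro L
    simp_rw [toENNReal_log_abs L]
    rw [integral_eq_lintegral_pos_part_sub_lintegral_neg_part (hint L), EReal.coe_sub,
      EReal.coe_ennreal_toReal (hint L).lintegral_lt_top.ne,
      EReal.coe_ennreal_toReal (x := ∫⁻ x, ENNReal.ofReal (-truncLog L x) ∂μ)
        (hint L).neg.lintegral_lt_top.ne]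
  simp_rw [heq, erealIntegral, sub_eq_add_neg]
  have h1 : Tendsto (fun L : ℕ => -((∫⁻ x, ENNReal.ofReal (-truncLog L x) ∂μ : ℝ≥0∞) : EReal)) atTop
      (𝓝 (-((∫⁻ x, (-ENNReal.log (ENNReal.ofReal |x|)).toENNReal ∂μ : ℝ≥0∞) : EReal))) :=
    (continuous_neg.tendsto _).comp
      ((continuous_coe_ennreal_ereal.tendsto _).comp (tendsto_lintegral_neg_truncLog μ))
  -- Finiteness of the positive part excludes the discontinuity of addition at ⊤ + ⊥.
  exact (EReal.continuousAt_add (Or.inl (EReal.coe_ennreal_eq_top_iff.not.2 hA))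
    (Or.inl (EReal.coe_ennreal_ne_bot _))).tendsto.comp
    (tendsto_const_nhds.prodMk_nhds h1)

theorem log_prod_abs_le (L : ℕ) (R : Multiset ℝ) (h : 0 < (R.map fun r => |r|).prod) :
    Real.log (R.map fun r => |r|).prod ≤ (R.map (truncLog L)).sum := by
  induction R using Multiset.induction_on with
  | empty => simp
  | cons r R ih =>
    rw [Multiset.map_cons, Multiset.prod_cons] at h ⊢
    have h1 : 0 < |r| := (abs_nonneg r).lt_of_ne' (left_ne_zero_of_mul h.ne')
    have h2 : 0 < (R.map fun r => |r|).prod := pos_of_mul_pos_right h h1.le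
    rw [Real.log_mul h1.ne' h2.ne', Multiset.map_cons, Multiset.sum_cons]
    exact add_le_add (Real.log_le_log h1 (le_max_left _ _)) (ih h2)

end LogIntegral

/-! ### Assembly of the limit theorem. -/

section Main

theorem log_numPerfectMatchings_div_le {V : Type u} [Fintype V] [Nonempty V] [DecidableEq V]
    (G : SimpleGraph V) (L : ℕ) :
    ENNReal.log (numPerfectMatchings G : ℝ≥0∞) / (Nat.card V : EReal) ≤
      ((∫ x, truncLog L x ∂(uniformMeasure (matchingRoots G)) : ℝ) : EReal) := by
  have hn : (0 : ℝ) < Fintype.card V := by exact_mod_cast Fintype.card_pos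
  rw [Nat.card_eq_fintype_card, integral_uniformMeasure, card_matchingRoots]
  by_cases h : numPerfectMatchings G = 0
  · rw [h, Nat.cast_zero, ENNReal.log_zero, EReal.bot_div_of_pos_ne_top]
    · exact bot_le
    · exact_mod_cast Fintype.card_pos
    · exact EReal.natCast_ne_top _
  · have hp : (0 : ℝ) < numPerfectMatchings G := by exact_mod_cast Nat.pos_of_ne_zero h
    have hp' := hp
    rw [← prod_abs_matchingRoots] at hp'
    rw [← ENNReal.ofReal_natCast, ENNReal.log_ofReal_of_pos hp, ← prod_abs_matchingRoots,
      ← EReal.coe_natCast, ← EReal.coe_div]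
    exact EReal.coe_le_coe_iff.2 (div_le_div_of_nonneg_right (log_prod_abs_le L _ hp') hn.le)

theorem exists_degreeBound_two_le {V : ℕ → Type u} {G : ∀ n, SimpleGraph (V n)}
    (h : ∃ d : ℕ, DegreeBound G d) :
    ∃ d : ℕ, 2 ≤ d ∧ DegreeBound G d := by
  obtain ⟨d, hd⟩ := h
  exact ⟨max d 2, le_max_right _ _, fun n v =>
    (hd n v).trans (by exact_mod_cast le_max_left d 2)⟩

theorem matchingMeasure_compl_rootInterval {V : Type u} [Fintype V] [DecidableEq V]
    {G : SimpleGraph V} {d : ℕ} (hd : 2 ≤ d) (hG : ∀ v, (freeNeighbors G ∅ v).card ≤ d) :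
    matchingMeasure G (Complex.ofReal '' rootInterval d)ᶜ = 0 := by
  have hmeas : MeasurableSet (Complex.ofReal '' rootInterval d)ᶜ :=
    (isCompact_Icc.image Complex.continuous_ofReal).isClosed.measurableSet.compl
  rw [matchingMeasure_eq, Measure.map_apply Complex.measurable_ofReal hmeas]
  refine uniformMeasure_eq_zero (Complex.measurable_ofReal hmeas) fun r hr hr' => hr' ?_
  exact ⟨r, mem_rootInterval_of_mem hd hG hr, rfl⟩

theorem exists_limit_measure {V : ℕ → Type u} [∀ n, Finite (V n)] [∀ n, Nonempty (V n)]
    {G : ∀ n, SimpleGraph (V n)} {d : ℕ} (hd : 2 ≤ d) (hG : DegreeBound G d) (h : BSConvergent G) :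
    ∃ ρ : ProbabilityMeasure ℝ,
      (ρ : Measure ℝ) (rootInterval d)ᶜ = 0 ∧
      Tendsto (fun n => matchingProbMeasure (G n)) atTop
        (𝓝 (ρ.map Complex.measurable_ofReal.aemeasurable)) ∧
      Tendsto (fun n => Real.log (numMatchings (G n)) / (Nat.card (V n) : ℝ)) atTop
        (𝓝 (1 / 2 * ∫ x in rootInterval d, Real.log (1 + x ^ 2) ∂(ρ : Measure ℝ))) ∧
      Tendsto (fun n => expectedMatchingSize (G n) / (Nat.card (V n) : ℝ)) atTop
        (𝓝 (1 / 2 * ∫ x in rootInterval d, x ^ 2 / (1 + x ^ 2) ∂(ρ : Measure ℝ))) ∧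
      Tendsto (fun n => varianceMatchingSize (G n) / (Nat.card (V n) : ℝ)) atTop
        (𝓝 (1 / 2 * ∫ x in rootInterval d, x ^ 2 / (1 + x ^ 2) ^ 2 ∂(ρ : Measure ℝ))) ∧
      Tendsto (fun n => (matchingNumber (G n) : ℝ) / (Nat.card (V n) : ℝ)) atTop
        (𝓝 ((1 - (ρ : Measure ℝ).real {0}) / 2)) ∧
      limsup (fun n => ENNReal.log (numPerfectMatchings (G n) : ℝ≥0∞) /
          (Nat.card (V n) : EReal)) atTop
        ≤ erealIntegral ((ρ : Measure ℝ).restrict (rootInterval d))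
            (fun x => ENNReal.log (ENNReal.ofReal |x|)) := by
  classical
  have : ∀ n, Fintype (V n) := fun n => Fintype.ofFinite (V n)
  have hd' : (2 : ℝ) ≤ d := by exact_mod_cast hd
  have hw0 : 0 ≤ 2 * √((d : ℝ) - 1) := by positivity
  have hw : 2 * √((d : ℝ) - 1) ≤ d := by
    have : √((d : ℝ) - 1) ≤ d / 2 := Real.sqrt_le_iff.2 ⟨by linarith, by nlinarith⟩
    linarith
  have hab : -(2 * √((d : ℝ) - 1)) ≤ 2 * √((d : ℝ) - 1) := by linarith
  have hR : ∀ n, ∀ r ∈ matchingRoots (G n), r ∈ rootInterval d := fun n r hr =>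
    mem_rootInterval_of_mem hd (card_freeNeighbors_le (hG n)) hr
  have hcard : ∀ n, (matchingRoots (G n)).card ≠ 0 := fun n => by
    rw [card_matchingRoots]
    exact Fintype.card_ne_zero
  let μ : ℕ → ProbabilityMeasure ℝ := fun n =>
    ⟨uniformMeasure (matchingRoots (G n)), isProbabilityMeasure_uniformMeasure (hcard n)⟩
  have hμ : ∀ n, (μ n : Measure ℝ) (rootInterval d)ᶜ = 0 := fun n =>
    uniformMeasure_eq_zero measurableSet_Icc.compl fun r hr hr' => hr' (hR n r hr)
  have hint : ∀ n (f : ℝ → ℝ), ∫ x, f x ∂(μ n : Measure ℝ) =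
      ((matchingRoots (G n)).map f).sum / Nat.card (V n) := fun n f => by
    rw [Nat.card_eq_fintype_card, ← card_matchingRoots (G n)]
    exact integral_uniformMeasure _ f
  -- The value `2 * d + 2` is the contraction threshold, and it lies to the right of the interval
  -- because 2√(d-1) ≤ d.
  have hmom := exists_tendsto_integral_pow (μ := fun n => (μ n : Measure ℝ)) hμ
    (x₀ := 2 * d + 2) (by linarith) fun x hx => by
      simp_rw [hint, Nat.card_eq_fintype_card]
      exact exists_tendsto_resolvent hd hG h hx
  obtain ⟨ρ, hρ, hlim⟩ := exists_tendsto_probabilityMeasure hμ fun f hf =>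
    exists_tendsto_integral_of_moments hμ hmom hf.continuousOn
  have hρ' : (ρ : Measure ℝ).restrict (rootInterval d) = ρ :=
    Measure.restrict_eq_self_of_ae_mem hρ
  have hconv : ∀ f : ℝ → ℝ, Continuous f → Tendsto (fun n =>
      ((matchingRoots (G n)).map f).sum / Nat.card (V n)) atTop
      (𝓝 (∫ x, f x ∂(ρ : Measure ℝ))) := fun f hf =>
    (tendsto_integral_of_continuous hab hμ hρ hlim hf.continuousOn).congr fun n => hint n f
  have hpos : ∀ x : ℝ, 1 + x ^ 2 ≠ 0 := fun x => by positivity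
  refine ⟨ρ, hρ, ?_, ?_, ?_, ?_, ?_, ?_⟩
  · refine (ProbabilityMeasure.tendsto_map_of_tendsto_of_continuous μ ρ hlim
      Complex.continuous_ofReal).congr fun n => Subtype.ext ?_
    exact (matchingMeasure_eq (G n)).symm
  · rw [hρ']
    refine ((hconv _ (Continuous.log (by fun_prop) hpos)).const_mul (1 / 2)).congr fun n => ?_
    rw [log_numMatchings, mul_div_assoc]
  · rw [hρ']
    refine ((hconv (fun x => x ^ 2 / (1 + x ^ 2))
      (Continuous.div (by fun_prop) (by fun_prop) hpos)).const_mul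
      (1 / 2)).congr fun n => ?_
    rw [expectedMatchingSize_eq_sum_roots, mul_div_assoc]
  · rw [hρ']
    refine ((hconv (fun x => x ^ 2 / (1 + x ^ 2) ^ 2)
      (Continuous.div (by fun_prop) (by fun_prop) fun x => pow_ne_zero 2 (hpos x))).const_mul
      (1 / 2)).congr fun n => ?_
    rw [varianceMatchingSize_eq_sum_roots, mul_div_assoc]
  · have h0 := tendsto_count_zero hcard (B := d) (by linarith)
      (fun n r hr => (abs_le.2 (hR n r hr)).trans hw)
      (fun n => one_le_prod_abs_nonzero_roots (G n)) (ρ := ρ) fun k =>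
        (hconv _ (continuous_tent k)).congr fun n => by
          rw [card_matchingRoots, Nat.card_eq_fintype_card]
    -- The fraction of zero roots is 1 - 2ν/v, which is solved for ν/v.
    refine ((h0.const_sub 1).div_const 2).congr fun n => ?_
    have hn : (0 : ℝ) < Fintype.card (V n) := by exact_mod_cast Fintype.card_pos
    rw [count_zero_matchingRoots, card_matchingRoots, Nat.card_eq_fintype_card,
      Nat.cast_sub (two_mul_matchingNumber_le (G n))]
    push_cast
    field_simp
    ring
  · rw [hρ']
    -- For fixed L the limsup is at most the integral of the continuous `truncLog L` against ρ; L
    -- tends to infinity only after n.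
    refine ge_of_tendsto (tendsto_integral_truncLog hρ) (Eventually.of_forall fun L => ?_)
    have hL := (hconv _ (continuous_truncLog L)).congr fun n => (hint n _).symm
    rw [← ((continuous_coe_real_ereal.tendsto _).comp hL).limsup_eq]
    exact limsup_le_limsup (Eventually.of_forall fun n => log_numPerfectMatchings_div_le (G n) L)

end Main

end MatchingBS

theorem mainTheorem2 :
    (∀ (d : ℕ), 2 ≤ d →
      ∀ (V : ℕ → Type u) [∀ n, Finite (V n)] [∀ n, Nonempty (V n)]
        (G : ∀ n, SimpleGraph (V n)),
      MatchingBS.DegreeBound G d → MatchingBS.BSConvergent G →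
      (∀ n, MatchingBS.matchingMeasure (G n)
        (Complex.ofReal '' MatchingBS.rootInterval d)ᶜ = 0) ∧
      ∃ ρ : ProbabilityMeasure ℝ,
        (ρ : Measure ℝ) (MatchingBS.rootInterval d)ᶜ = 0 ∧
        Tendsto (fun n => MatchingBS.matchingProbMeasure (G n)) atTop
          (𝓝 (ρ.map Complex.measurable_ofReal.aemeasurable)) ∧
        Tendsto (fun n => Real.log (MatchingBS.numMatchings (G n)) / (Nat.card (V n) : ℝ)) atTop
          (𝓝 (1 / 2 * ∫ x in MatchingBS.rootInterval d, Real.log (1 + x ^ 2) ∂(ρ : Measure ℝ))) ∧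
        Tendsto (fun n => MatchingBS.expectedMatchingSize (G n) / (Nat.card (V n) : ℝ)) atTop
          (𝓝 (1 / 2 * ∫ x in MatchingBS.rootInterval d,
            x ^ 2 / (1 + x ^ 2) ∂(ρ : Measure ℝ))) ∧
        Tendsto (fun n => MatchingBS.varianceMatchingSize (G n) / (Nat.card (V n) : ℝ)) atTop
          (𝓝 (1 / 2 * ∫ x in MatchingBS.rootInterval d,
            x ^ 2 / (1 + x ^ 2) ^ 2 ∂(ρ : Measure ℝ))) ∧
        Tendsto (fun n => (MatchingBS.matchingNumber (G n) : ℝ) / (Nat.card (V n) : ℝ)) atTop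
          (𝓝 ((1 - (ρ : Measure ℝ).real {0}) / 2)) ∧
        limsup (fun n => ENNReal.log (MatchingBS.numPerfectMatchings (G n) : ℝ≥0∞) /
            (Nat.card (V n) : EReal)) atTop
          ≤ MatchingBS.erealIntegral ((ρ : Measure ℝ).restrict (MatchingBS.rootInterval d))
              (fun x => ENNReal.log (ENNReal.ofReal |x|))) ∧
    MatchingBS.Estimable (fun (V : Type u) (G : SimpleGraph V) =>
      Real.log (MatchingBS.numMatchings G) / (Nat.card V : ℝ)) ∧
    MatchingBS.Estimable (fun (V : Type u) (G : SimpleGraph V) =>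
      MatchingBS.expectedMatchingSize G / (Nat.card V : ℝ)) ∧
    MatchingBS.Estimable (fun (V : Type u) (G : SimpleGraph V) =>
      MatchingBS.varianceMatchingSize G / (Nat.card V : ℝ)) ∧
    MatchingBS.Estimable (fun (V : Type u) (G : SimpleGraph V) =>
      (MatchingBS.matchingNumber G : ℝ) / (Nat.card V : ℝ)) := by
  refine ⟨fun d hd V _ _ G hG h => ⟨fun n => ?_, MatchingBS.exists_limit_measure hd hG h⟩,
    fun V _ _ G hG h => ?_, fun V _ _ G hG h => ?_, fun V _ _ G hG h => ?_,
    fun V _ _ G hG h => ?_⟩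
  · classical
    have := Fintype.ofFinite (V n)
    exact MatchingBS.matchingMeasure_compl_rootInterval hd
      (MatchingBS.card_freeNeighbors_le (hG n))
  all_goals
    obtain ⟨d, hd, hG'⟩ := MatchingBS.exists_degreeBound_two_le hG
    obtain ⟨ρ, -, -, h1, h2, h3, h4, -⟩ := MatchingBS.exists_limit_measure hd hG' h
  · exact ⟨_, h1⟩
  · exact ⟨_, h2⟩
  · exact ⟨_, h3⟩
  · exact ⟨_, h4⟩
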